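/- **Setting.** Let $P$ be a $\varphi$-irreducible aperiodic Markov kernel on a measurable space $\mathcal X\times\mathcal Y$ with stationary law $\pi$. For probability measures put $\|Q-Q'\|_{TV}=\sup_A|Q(A)-Q'(A)|$. Let $t_{mix}=\min\{t\ge 1:\sup_x\|P^t(x,\cdot)-\pi\|_{TV}\le 1/4\}$, assumed finite, and $n_0=\tfrac94 t_{mix}$. Let $W_{-1}$ be the lower branch of the Lambert function, i.e. for $-1/e\le x<0$, $W_{-1}(x)$ is the unique $z\le -1$ with $ze^z=x$. Let $N\ge1$, $n\ge 1$ and $\alpha\in(0,1)$. The training data $D=(Z_{1-N},\dots,Z_0)$, $Z_i=(X_i,Y_i)$, are observed along a Markov chain with kernel $P$, where $Z_i\sim\nu_0P^{N+i}$ (that is, $\nu_0$ is the law of the unobserved state $Z_{-N}$). A jointly measurable real score function $s_D(x,y)$ is fitted on $D$. The calibration points $Z_1,\dots,Z_n$ and the test point $Z_{n+1}$ are * *without restart*: the continuation of the same trajectory; or * *with restart*: taken from a chain with kernel $P$ independent of the training chain, with $Z_i\sim\nu_1P^i$. Put $S_i=s_D(Z_i)$, and let $\hat q_{\alpha,n}$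 be the smallest $q$ such that at least $\lceil (n+1)(1-\alpha)\rceil$ of $S_1,\dots,S_n$ are $\le q$ ($+\infty$ if there is none). Put $\delta(k)=\|\nu_0P^k-\pi\|_{TV}$ and $\delta_1(k)=\|\nu_1P^k-\pi\|_{TV}$. Let $\beta(a)=\sup_{t\ge1}\|\mathbb P_1^t\otimes\mathbb P_{t+a}^\infty-\mathbb P_{t,a}\|_{TV}$ be the $\beta$-mixing coefficients of the trajectory started at $Z_{1-N}$, where, numbering its states $1,2,\dots$ from $Z_{1-N}$ on, $\mathbb P_1^t$, $\mathbb P_{t+a}^\infty$ and $\mathbb P_{t,a}$ are the law of its first $t$ states, the law of its states from the $(t+a)$-th on, and their joint law. **1. Coverage with restart.** If $n\ge e\,n_0$, then with $$\gamma=\sqrt{-W_{-1}\!\left(-\tfrac{n_0}{n}\right)\tfrac{n_0}{n}}+\exp\!\left(\tfrac12W_{-1}\!\left(-\tfrac{n_0}{n}\right)\right)+\frac1n\sum_{i=1}^n\delta_1(i)+\delta_1(n+1)$$ one has $\mathbb P(S_{n+1}\le\hat q_{\alpha,n})\ge 1-\alpha-\gamma$. If moreover, for almost every $D$, the law of $s_D(Z)$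 for $Z\sim\pi$ has no atoms, then $\mathbb P(S_{n+1}\le\hat q_{\alpha,n})\le 1-\alpha+\gamma+\frac{1-\alpha}{n}$. **2. Coverage without restart.** For every integer $r\ge1$ with $n-r\ge e\,n_0$, with $$\gamma(r)=\sqrt{-W_{-1}\!\left(-\tfrac{n_0}{n-r}\right)\tfrac{n_0}{n-r}}+\exp\!\left(\tfrac12W_{-1}\!\left(-\tfrac{n_0}{n-r}\right)\right)+\frac{1+r\alpha}{n+1}+\delta(N)+\delta(n+N+1)+\beta(n+1)+\beta(r)$$ one has $\mathbb P(S_{n+1}\le\hat q_{\alpha,n})\ge 1-\alpha-\gamma(r)$. Under the same no-atoms condition, $\mathbb P(S_{n+1}\le\hat q_{\alpha,n})\le 1-\alpha+\gamma(r)+\frac{1-\alpha}{n-r}$. **3. Geometrically ergodic chains.** Suppose in addition that the chain is geometrically ergodic: for some $\rho_0<1$ and $\pi$-almost every $x$ there is $M(x)<\infty$ with $\|P^k(x,\cdot)-\pi\|_{TV}\le M(x)\rho_0^k$ for all $k$. Then for every initial law there are $C$ and $\rho\in(0,1)$ with $\delta(k)\le C\rho^k$ and $\beta(k)\le C\rho^k$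 for all $k\ge1$. Moreover there is an absolute constant $K$ such that, for any $C,\rho$ with these properties, for all $n\ge n_1(t_{mix},C,\rho)$: * *with restart* (where only $\delta_1(k)\le C\rho^k$ for $k\ge 1$ is required): $n\ge e\,n_0$ and $\gamma\le K\sqrt{t_{mix}\ln n/n}$; * *without restart*, with $r=\lceil \ln n/\ln(1/\rho)\rceil$: $r\ge1$, $n-r\ge e\,n_0$, and, for every $\alpha\in(0,1)$ and $N\ge1$, $\gamma(r)\le K\sqrt{t_{mix}\ln n/n}+\delta(N)$; if $N\ge r$, then $\gamma(r)\le K\sqrt{t_{mix}\ln n/n}$. -/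

import Mathlib

open MeasureTheory ProbabilityTheory
open scoped ENNReal

universe u v w

noncomputable section

namespace MarkovConformal

/-- Total variation distance `sup_A |P(A) - Q(A)|` over measurable sets `A`. -/
def tvDist {E : Type*} [MeasurableSpace E] (P Q : Measure E) : ℝ :=
  ⨆ A : {A : Set E // MeasurableSet A}, |P.real A.1 - Q.real A.1|

/-- `Z 0, Z 1, …` is a time-homogeneous Markov chain under `μ`, with initial law `ν` (the law of
`Z 0`) and transition kernel `κ`: the joint law of the history `(Z 0, …, Z k)` and of `Z (k + 1)`
is the law of the history followed by one step of `κ` from its last state. -/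
structure IsMarkovChain {Ω E : Type*} [MeasurableSpace Ω] [MeasurableSpace E]
    (μ : Measure Ω) (Z : ℕ → Ω → E) (ν : Measure E) (κ : Kernel E E) : Prop where
  measurable : ∀ k, Measurable (Z k)
  initial : μ.map (Z 0) = ν
  step : ∀ k : ℕ,
    μ.map (fun ω => ((fun i : Fin (k + 1) => Z i ω), Z (k + 1) ω)) =
      (μ.map (fun ω => fun i : Fin (k + 1) => Z i ω)) ⊗ₘ
        (κ.comap (fun h : Fin (k + 1) → E => h (Fin.last k)) (measurable_pi_apply (Fin.last k)))

/-- Aperiodicity of a kernel with invariant law `π`: there is no cycle `D 0 → D 1 → … → D 0` of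
`d ≥ 2` pairwise disjoint measurable sets with `π (D 0) > 0` that the chain follows surely. -/
def IsAperiodic {E : Type*} [MeasurableSpace E] (κ : Kernel E E) (π : Measure E) : Prop :=
  ¬ ∃ d : ℕ, 2 ≤ d ∧ ∃ D : ZMod d → Set E,
    (∀ i, MeasurableSet (D i)) ∧ Pairwise (fun i j => Disjoint (D i) (D j)) ∧
      (∀ i, ∀ x ∈ D i, κ x (D (i + 1)) = 1) ∧ 0 < π (D 0)

/-- `κ` is `φ`-irreducible for some nonzero σ-finite measure `φ`, aperiodic, and has the
stationary law `π`. -/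
structure IsIrreducibleAperiodic {E : Type*} [MeasurableSpace E] (κ : Kernel E E)
    (π : Measure E) : Prop where
  invariant : Kernel.Invariant κ π
  irreducible : ∃ φ : Measure E, φ ≠ 0 ∧ SigmaFinite φ ∧ Kernel.IsIrreducible φ κ
  aperiodic : IsAperiodic κ π

/-- Geometric ergodicity: for some rate `ρ < 1`, for `π`-almost every `x` there is a finite `M x`
with `‖P^k(x, ·) - π‖_TV ≤ M x * ρ ^ k` for all `k`. -/
def IsGeometricallyErgodic {E : Type*} [MeasurableSpace E] (κ : Kernel E E)
    (π : Measure E) : Prop :=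
  ∃ (ρ : ℝ) (M : E → ℝ), 0 ≤ ρ ∧ ρ < 1 ∧
    ∀ᵐ x ∂π, ∀ k : ℕ, tvDist ((κ ^ k) x) π ≤ M x * ρ ^ k

/-- The mixing time `t_mix = min {t ≥ 1 : sup_x ‖P^t(x, ·) - π‖_TV ≤ 1/4}`, equal to `⊤` if there
is no such `t`. -/
def mixingTime {E : Type*} [MeasurableSpace E] (κ : Kernel E E) (π : Measure E) : ℕ∞ :=
  ⨅ (t : ℕ) (_ : 1 ≤ t ∧ ∀ x, tvDist ((κ ^ t) x) π ≤ 1 / 4), (t : ℕ∞)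

/-- `δ(k) = ‖ν P^k - π‖_TV`. -/
def tvToStationary {E : Type*} [MeasurableSpace E] (κ : Kernel E E) (ν π : Measure E)
    (k : ℕ) : ℝ :=
  tvDist (ν.bind (κ ^ k)) π

/-- The β-mixing coefficient of the sequence `Z 1, Z 2, …`: the supremum over `t ≥ 1` of the total
variation distance between the product of the laws of `(Z 1, …, Z t)` and
`(Z (t + a), Z (t + a + 1), …)`, and their joint law. -/
def betaMixing {Ω E : Type*} [MeasurableSpace Ω] [MeasurableSpace E]
    (μ : Measure Ω) (Z : ℕ → Ω → E) (a : ℕ) : ℝ :=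
  ⨆ t : {t : ℕ // 1 ≤ t},
    tvDist
      ((μ.map (fun ω => fun i : Fin t.1 => Z (i + 1) ω)).prod
        (μ.map (fun ω => fun j : ℕ => Z (t.1 + a + j) ω)))
      (μ.map (fun ω => ((fun i : Fin t.1 => Z (i + 1) ω), fun j : ℕ => Z (t.1 + a + j) ω)))

/-- The branch `W_{-1}` of the Lambert function: for `-1/e ≤ x < 0`, the unique `z ≤ -1` with
`z * exp z = x`. -/
def lambertWm1 (x : ℝ) : ℝ :=
  sSup {z : ℝ | z ≤ -1 ∧ z * Real.exp z = x}

/-- The split conformal quantile of the `n` calibration scores: the smallest `q` such that at least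
`⌈(n + 1)(1 - α)⌉` of the scores are at most `q`; it is `⊤` if `⌈(n + 1)(1 - α)⌉ > n`. -/
def conformalQuantile (α : ℝ) {n : ℕ} (scores : Fin n → ℝ) : EReal :=
  sInf {q : EReal |
    ⌈((n : ℝ) + 1) * (1 - α)⌉₊ ≤ (Finset.univ.filter fun i => ((scores i : ℝ) : EReal) ≤ q).card}

/-- The training set: the first `N` observations `Z 1, …, Z N`. -/
def trainingSet {Ω E : Type*} (Z : ℕ → Ω → E) (N : ℕ) (ω : Ω) : Fin N → E :=
  fun i => Z (i + 1) ω

/-- Split conformal coverage event: given the training set `D`, a calibration sample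
`V (m + 1), …, V (m + n)` and the test point `V (m + n + 1)`, the score of the test point is at most
the conformal quantile of the calibration scores. Here `s d` is the score function fitted on the
training set `d`. -/
def coverageEvent {Ω E : Type*} {N : ℕ} (s : (Fin N → E) → E → ℝ) (D : Ω → Fin N → E)
    (V : ℕ → Ω → E) (m n : ℕ) (α : ℝ) : Set Ω :=
  {ω | ((s (D ω) (V (m + n + 1) ω) : ℝ) : EReal) ≤
    conformalQuantile α (fun i : Fin n => s (D ω) (V (m + 1 + i) ω))}

/-- `n₀ = (9/4) t_mix`. -/
def nZero (tmix : ℕ) : ℝ := 9 / 4 * tmix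

/-- The leading part of the coverage gap, for an effective sample size `x`:
`√(-W_{-1}(-n₀/x) n₀/x) + exp (W_{-1}(-n₀/x) / 2)`. -/
def lambertGap (tmix : ℕ) (x : ℝ) : ℝ :=
  Real.sqrt (-lambertWm1 (-(nZero tmix / x)) * (nZero tmix / x)) +
    Real.exp (1 / 2 * lambertWm1 (-(nZero tmix / x)))

/-- The coverage gap `γ` with a restart, where `δ₁ k = ‖ν₁ P^k - π‖_TV`. -/
def gapRestart (tmix : ℕ) (δ₁ : ℕ → ℝ) (n : ℕ) : ℝ :=
  lambertGap tmix n + 1 / n * ∑ i ∈ Finset.Icc 1 n, δ₁ i + δ₁ (n + 1)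

/-- The coverage gap `γ(r)` without a restart, where `δ k = ‖ν₀ P^k - π‖_TV` and `β` is the
β-mixing coefficient. -/
def gapNoRestart (tmix : ℕ) (δ β : ℕ → ℝ) (α : ℝ) (N n r : ℕ) : ℝ :=
  lambertGap tmix ((n : ℝ) - r) + (1 + r * α) / (n + 1) + δ N + δ (n + N + 1) + β (n + 1) + β r

end MarkovConformal

end

open MarkovConformal

/-!
Write `t` for the mixing time. At time `t` any two rows of the kernel differ by at most `1 / 2` in
total variation, so `κ ^ t` halves the oscillation of every function (`HalvesOscillation`). Hence
both `‖ν κᵏ - π‖` and the `k`-th β-mixing coefficient are at most `(1 / 2) ^ ⌊k / t⌋`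
(`tvToStationary_le`, `IsMarkovChain.betaMixing_le`), whatever the initial law. This already gives
the geometric bounds.

*Concentration.* The sum `∑ g (Z i)` of a function of oscillation at most `1` is split into `t`
subsequences of time step `t`. In each of them Hoeffding's lemma is applied backwards in time: the
function that carries the conditional mean of the remaining terms keeps oscillation at most `2`,
because `1 + 2 / 2 = 2`. The whole sum of `n` terms is therefore sub-Gaussian with variance proxy
`t n` (`IsMarkovChain.measureReal_sum_ge_le`). With `n₀ = (9 / 4) t` this is better than an exponent
`n u² / (2 n₀)` by the factor `9 / 4`.

*Coverage of a fixed score.* Let `q` be a deterministic quantile, under `π`, of a level that differs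
from `1 - α` by the deviation `u` and the average bias. Unless the empirical frequency deviates by
more than `u`, the conformal quantile lies on the right side of `q`, and the test score is compared
with `q`. No independence of calibration and test points is involved
(`IsMarkovChain.le_measureReal_fixedCoverage`, `IsMarkovChain.measureReal_fixedCoverage_le`). With
`w = -W₋₁(-n₀ / x)`, the choice `u = √(w n₀ / x)` produces the leading term.

*Fitted scores.* With a restart, the training set is independent of the other points and can be
fixed. Without a restart, conditionally on the past up to the last training point the score function
is fixed and the chain restarts from that point (`IsMarkovChain.measure_coverageEvent`). The bias of
a chain started anywhere is at most `n₀ / n`. Lowering `u` by this amount costs nothing, thanks to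
the factor `9 / 4`, except when `exp w < 9`; in that case the leading term is at least `1` and there
is nothing to prove (`IsMarkovChain.coverage_of_any_start`). So the leading term alone bounds the
coverage gap; the other, nonnegative, terms of `γ(r)` only weaken the bound.

*Rates.* From `w exp (-w) = n₀ / x` follow `w ≤ 2 log x` and `exp (-w / 2) ≤ √(n₀ / x)`
(`lambertGap_le`), which bounds the leading term by `6 √(t log n / n)` for `n / 2 ≤ x ≤ n`; the
remaining terms are `O(log n / n)`.
-/

namespace MarkovConformal

/-! ### Total variation distance and oscillation -/

section TotalVariation

variable {E : Type*} [MeasurableSpace E]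

lemma tvDist_nonneg (P Q : Measure E) : 0 ≤ tvDist P Q :=
  Real.iSup_nonneg fun _ => abs_nonneg _

lemma abs_measureReal_sub_le_tvDist (P Q : Measure E) [IsProbabilityMeasure P]
    [IsProbabilityMeasure Q] {A : Set E} (hA : MeasurableSet A) :
    |P.real A - Q.real A| ≤ tvDist P Q := by
  refine le_ciSup (f := fun A : {A : Set E // MeasurableSet A} => |P.real A.1 - Q.real A.1|)
    ⟨1, ?_⟩ ⟨A, hA⟩
  rintro _ ⟨B, rfl⟩
  have h1 : P.real B.1 ≤ 1 := measureReal_le_one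
  have h2 : Q.real B.1 ≤ 1 := measureReal_le_one
  have h3 : 0 ≤ P.real B.1 := measureReal_nonneg
  have h4 : 0 ≤ Q.real B.1 := measureReal_nonneg
  exact abs_le.2 ⟨by linarith, by linarith⟩

lemma tvDist_le {P Q : Measure E} {c : ℝ}
    (h : ∀ A, MeasurableSet A → |P.real A - Q.real A| ≤ c) : tvDist P Q ≤ c := by
  have : Nonempty {A : Set E // MeasurableSet A} := ⟨⟨∅, MeasurableSet.empty⟩⟩
  exact ciSup_le fun A => h A.1 A.2

/-- A function of oscillation at most `c` takes its values in an interval of length `c`. -/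
lemma exists_forall_mem_Icc_of_osc_le {E : Type*} [Nonempty E] {f : E → ℝ} {c : ℝ}
    (hf : ∀ x y, f x - f y ≤ c) : ∃ a, ∀ x, f x ∈ Set.Icc a (a + c) := by
  obtain ⟨x₀⟩ := ‹Nonempty E›
  have hb : BddBelow (Set.range f) := by
    refine ⟨f x₀ - c, ?_⟩
    rintro _ ⟨y, rfl⟩
    linarith [hf x₀ y]
  refine ⟨⨅ x, f x, fun x => ⟨ciInf_le hb x, ?_⟩⟩
  have : f x - c ≤ ⨅ y, f y := by
    have : Nonempty E := ⟨x₀⟩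
    exact le_ciInf fun y => by linarith [hf x y]
  linarith

lemma integrable_of_osc_le {f : E → ℝ} (hfm : Measurable f) {c : ℝ}
    (hf : ∀ x y, f x - f y ≤ c) (P : Measure E) [IsProbabilityMeasure P] : Integrable f P := by
  have : Nonempty E := P.nonempty_of_neZero
  obtain ⟨a, ha⟩ := exists_forall_mem_Icc_of_osc_le hf
  exact Integrable.of_mem_Icc a (a + c) hfm.aemeasurable (ae_of_all _ ha)

/-- Two probability measures integrate a function of oscillation `c` to values that differ by at
most `c` times their total variation distance. -/
lemma integral_sub_integral_le {P Q : Measure E} [IsProbabilityMeasure P]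
    [IsProbabilityMeasure Q] {ε c : ℝ} (hPQ : ∀ A, MeasurableSet A → P.real A - Q.real A ≤ ε)
    {f : E → ℝ} (hfm : Measurable f) (hf : ∀ x y, f x - f y ≤ c) :
    ∫ x, f x ∂P - ∫ x, f x ∂Q ≤ ε * c := by
  have : Nonempty E := P.nonempty_of_neZero
  obtain ⟨a, ha⟩ := exists_forall_mem_Icc_of_osc_le hf
  have hc : 0 ≤ c := by
    obtain ⟨x₀⟩ := ‹Nonempty E›
    simpa using hf x₀ x₀
  set g : E → ℝ := fun x => f x - a with hg
  have hgm : Measurable g := hfm.sub_const a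
  have key : ∀ ρ : Measure E, IsProbabilityMeasure ρ → Integrable g ρ ∧
      ∫ x, f x ∂ρ = a + ∫ t in Set.Ioc 0 c, ρ.real {x | t ≤ g x} := by
    intro ρ hρ
    have hfi : Integrable f ρ := integrable_of_osc_le hfm hf ρ
    have hgi : Integrable g ρ := hfi.sub (integrable_const a)
    refine ⟨hgi, ?_⟩
    rw [← hgi.integral_eq_integral_Ioc_meas_le (ae_of_all _ fun x => by
      have := (ha x).1; simp only [hg, Pi.zero_apply]; linarith)
      (ae_of_all _ fun x => by have := (ha x).2; simp only [hg]; linarith)]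
    simp only [hg]
    rw [integral_sub hfi (integrable_const a)]
    simp
  rw [(key P inferInstance).2, (key Q inferInstance).2]
  have hint : ∀ ρ : Measure E, IsProbabilityMeasure ρ →
      IntegrableOn (fun t => ρ.real {x | t ≤ g x}) (Set.Ioc 0 c) := by
    intro ρ hρ
    have hanti : Antitone fun t : ℝ => ρ.real {x | t ≤ g x} := fun s t hst =>
      measureReal_mono fun x (hx : t ≤ g x) => hst.trans hx
    refine Integrable.of_mem_Icc 0 1 hanti.measurable.aemeasurable
      (ae_of_all _ fun t => ⟨measureReal_nonneg, measureReal_le_one⟩)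
  have hle : ∫ t in Set.Ioc 0 c, (P.real {x | t ≤ g x} - Q.real {x | t ≤ g x}) ≤
      ∫ _ in Set.Ioc 0 c, ε :=
    integral_mono ((hint P inferInstance).sub (hint Q inferInstance)) (integrable_const _)
      fun t => hPQ _ (measurableSet_le measurable_const hgm)
  rw [integral_sub (hint P inferInstance) (hint Q inferInstance)] at hle
  simp only [integral_const, MeasurableSet.univ, measureReal_restrict_apply, Set.univ_inter,
    Real.volume_real_Ioc_of_le hc, smul_eq_mul, sub_zero] at hle
  linarith

/-- Averaging a function of oscillation `c` in two ways gives values that differ by at most `c`. -/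
lemma integral_sub_integral_le_of_osc_le {P Q : Measure E} [IsProbabilityMeasure P]
    [IsProbabilityMeasure Q] {c : ℝ} {f : E → ℝ} (hfm : Measurable f)
    (hf : ∀ x y, f x - f y ≤ c) : ∫ x, f x ∂P - ∫ x, f x ∂Q ≤ c := by
  have := integral_sub_integral_le (P := P) (Q := Q) (ε := 1) (fun A _ => by
    have h1 : P.real A ≤ 1 := measureReal_le_one
    have h2 : 0 ≤ Q.real A := measureReal_nonneg
    linarith) hfm hf
  simpa using this

end TotalVariation

/-! ### Contraction of oscillations by the powers of a kernel -/

section Contraction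

variable {E : Type*} [MeasurableSpace E] {κ : Kernel E E}

instance isMarkovKernel_pow [IsMarkovKernel κ] (k : ℕ) : IsMarkovKernel (κ ^ k) := by
  induction k with
  | zero => exact inferInstanceAs (IsMarkovKernel (Kernel.id : Kernel E E))
  | succ k ih => exact inferInstanceAs (IsMarkovKernel ((κ ^ k) ∘ₖ κ))

lemma measureReal_pow_add [IsMarkovKernel κ] (m n : ℕ) (x : E) {A : Set E}
    (hA : MeasurableSet A) :
    ((κ ^ (m + n)) x).real A = ∫ y, ((κ ^ n) y).real A ∂((κ ^ m) x) := by
  rw [measureReal_def, Kernel.pow_add_apply_eq_lintegral κ m n x hA,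
    integral_eq_lintegral_of_nonneg_ae (ae_of_all _ fun _ => measureReal_nonneg)
      ((Kernel.measurable_coe _ hA).ennreal_toReal.aestronglyMeasurable)]
  simp

lemma measureReal_bind [IsMarkovKernel κ] (ν : Measure E) {A : Set E} (hA : MeasurableSet A) :
    (ν.bind κ).real A = ∫ y, (κ y).real A ∂ν := by
  rw [measureReal_def, Measure.bind_apply hA κ.aemeasurable,
    integral_eq_lintegral_of_nonneg_ae (ae_of_all _ fun _ => measureReal_nonneg)
      ((Kernel.measurable_coe _ hA).ennreal_toReal.aestronglyMeasurable)]
  simp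

/-- Any two rows of `κ` differ by at most `1/2` in total variation. Equivalently, `κ` contracts the
oscillation of bounded functions by the factor `1/2`, see `HalvesOscillation.integral_sub_le`. -/
def HalvesOscillation (κ : Kernel E E) : Prop :=
  ∀ x y A, MeasurableSet A → (κ x).real A - (κ y).real A ≤ 1 / 2

lemma HalvesOscillation.integral_sub_le [IsMarkovKernel κ] (hκ : HalvesOscillation κ)
    {f : E → ℝ} {c : ℝ} (hfm : Measurable f) (hf : ∀ x y, f x - f y ≤ c) (x y : E) :
    ∫ z, f z ∂(κ x) - ∫ z, f z ∂(κ y) ≤ c / 2 := by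
  have := integral_sub_integral_le (hκ x y) hfm hf
  linarith

lemma halvesOscillation_of_tvDist_le [IsMarkovKernel κ] {π : Measure E} [IsProbabilityMeasure π]
    (h : ∀ x, tvDist (κ x) π ≤ 1 / 4) : HalvesOscillation κ := by
  intro x y A hA
  have h1 := (abs_le.1 ((abs_measureReal_sub_le_tvDist (κ x) π hA).trans (h x))).2
  have h2 := (abs_le.1 ((abs_measureReal_sub_le_tvDist (κ y) π hA).trans (h y))).1
  linarith

/-- The chain forgets its starting point at a geometric rate: each block of `t` steps halves the
oscillation of `x ↦ (κ ^ k) x A`. -/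
lemma pow_measureReal_sub_le [IsMarkovKernel κ] {t : ℕ} (ht : 1 ≤ t)
    (hκ : HalvesOscillation (κ ^ t)) (k : ℕ) {A : Set E} (hA : MeasurableSet A) (x y : E) :
    ((κ ^ k) x).real A - ((κ ^ k) y).real A ≤ (1 / 2) ^ (k / t) := by
  induction k using Nat.strong_induction_on generalizing x y with
  | _ k ih =>
    rcases lt_or_ge k t with hk | hk
    · rw [Nat.div_eq_of_lt hk]
      have h1 : ((κ ^ k) x).real A ≤ 1 := measureReal_le_one
      have h2 : 0 ≤ ((κ ^ k) y).real A := measureReal_nonneg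
      simp only [pow_zero]
      linarith
    · obtain ⟨l, rfl⟩ := Nat.exists_eq_add_of_le hk
      rw [measureReal_pow_add t l x hA, measureReal_pow_add t l y hA]
      have := hκ.integral_sub_le (f := fun z => ((κ ^ l) z).real A)
        ((Kernel.measurable_coe _ hA).ennreal_toReal) (ih l (by omega)) x y
      rw [Nat.add_div_left l (by omega), pow_succ]
      linarith

lemma bind_pow_eq_of_invariant [IsMarkovKernel κ] {π : Measure E} (hπ : Kernel.Invariant κ π)
    (k : ℕ) : π.bind (κ ^ k) = π := by
  have : Kernel.Invariant (κ ^ k) π := by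
    induction k with
    | zero =>
      change π.bind (Kernel.id : Kernel E E) = π
      exact Measure.bind_dirac
    | succ k ih => exact ih.comp hπ
  exact this

lemma abs_measureReal_bind_sub_le [IsMarkovKernel κ] {π ν : Measure E} [IsProbabilityMeasure π]
    [IsProbabilityMeasure ν] (hπ : Kernel.Invariant κ π) {t : ℕ} (ht : 1 ≤ t)
    (hκ : HalvesOscillation (κ ^ t)) (k : ℕ) {A : Set E} (hA : MeasurableSet A) :
    |(ν.bind (κ ^ k)).real A - π.real A| ≤ (1 / 2) ^ (k / t) := by
  have hm : Measurable fun z => ((κ ^ k) z).real A :=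
    (Kernel.measurable_coe _ hA).ennreal_toReal
  have h := pow_measureReal_sub_le ht hκ k hA
  have hπk : π.real A = ∫ z, ((κ ^ k) z).real A ∂π := by
    rw [← measureReal_bind π hA, bind_pow_eq_of_invariant hπ k]
  rw [measureReal_bind ν hA, hπk]
  exact abs_sub_le_iff.2 ⟨integral_sub_integral_le_of_osc_le hm h,
    integral_sub_integral_le_of_osc_le hm h⟩

lemma tvToStationary_le [IsMarkovKernel κ] {π ν : Measure E} [IsProbabilityMeasure π]
    [IsProbabilityMeasure ν] (hπ : Kernel.Invariant κ π) {t : ℕ} (ht : 1 ≤ t)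
    (hκ : HalvesOscillation (κ ^ t)) (k : ℕ) : tvToStationary κ ν π k ≤ (1 / 2) ^ (k / t) :=
  tvDist_le fun _ hA => abs_measureReal_bind_sub_le hπ ht hκ k hA

lemma tvToStationary_nonneg (κ : Kernel E E) (ν π : Measure E) (k : ℕ) :
    0 ≤ tvToStationary κ ν π k := tvDist_nonneg _ _

/-- A finite mixing time is at least `1` and is attained. -/
lemma mixingTime_spec [IsMarkovKernel κ] {π : Measure E} [IsProbabilityMeasure π] {t : ℕ}
    (h : mixingTime κ π = t) : 1 ≤ t ∧ HalvesOscillation (κ ^ t) := by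
  have hmem : 1 ≤ t ∧ ∀ x, tvDist ((κ ^ t) x) π ≤ 1 / 4 := by
    by_contra hne
    have : ((t + 1 : ℕ) : ℕ∞) ≤ mixingTime κ π ∨ ∃ s : ℕ, s ≤ t ∧
        (1 ≤ s ∧ ∀ x, tvDist ((κ ^ s) x) π ≤ 1 / 4) := by
      by_cases hs : ∃ s : ℕ, s ≤ t ∧ (1 ≤ s ∧ ∀ x, tvDist ((κ ^ s) x) π ≤ 1 / 4)
      · exact Or.inr hs
      · push Not at hs
        refine Or.inl (le_iInf₂ fun s hs' => ?_)
        by_contra hlt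
        have hst : s < t + 1 := by exact_mod_cast not_le.1 hlt
        obtain ⟨x, hx⟩ := hs s (by omega) hs'.1
        exact absurd (hs'.2 x) (not_le.2 hx)
    rcases this with h1 | ⟨s, hst, hs⟩
    · rw [h] at h1
      have : t + 1 ≤ t := by exact_mod_cast h1
      omega
    · have : mixingTime κ π ≤ s := iInf₂_le s hs
      rw [h] at this
      have : t ≤ s := by exact_mod_cast this
      obtain rfl : s = t := le_antisymm hst this
      exact hne hs
  exact ⟨hmem.1, halvesOscillation_of_tvDist_le hmem.2⟩

end Contraction

/-! ### The Markov property on path space -/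

section MarkovProperty

variable {Ω E H : Type*} [MeasurableSpace Ω] [MeasurableSpace E] [MeasurableSpace H]
  {μ : Measure Ω} {κ : Kernel E E}

lemma IsMarkovChain.lintegral_step [IsProbabilityMeasure μ] [IsMarkovKernel κ] {Z : ℕ → Ω → E}
    {ν : Measure E} (hZ : IsMarkovChain μ Z ν κ) (k : ℕ) {F : (Fin (k + 1) → E) × E → ℝ≥0∞}
    (hF : Measurable F) :
    ∫⁻ ω, F (fun i : Fin (k + 1) => Z i ω, Z (k + 1) ω) ∂μ =
      ∫⁻ ω, ∫⁻ y, F (fun i : Fin (k + 1) => Z i ω, y) ∂(κ (Z k ω)) ∂μ := by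
  have hm : Measurable fun ω => fun i : Fin (k + 1) => Z i ω :=
    measurable_pi_lambda _ fun i => hZ.measurable i
  rw [← lintegral_map (μ := μ) (f := F) hF (hm.prodMk (hZ.measurable (k + 1))), hZ.step k,
    Measure.lintegral_compProd hF, lintegral_map _ hm]
  · simp [Kernel.comap_apply]
  · exact hF.lintegral_kernel_prod_right'

/-- After an observation `X`, the sequence `Y` evolves as a Markov chain with kernel `κ`: the
conditional law of `Y (m + 1)` given `X, Y 0, …, Y m` is `κ (Y m)`. -/
def IsMarkovAfter (μ : Measure Ω) (X : Ω → H) (Y : ℕ → Ω → E) (κ : Kernel E E) : Prop :=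
  ∀ (m : ℕ) (F : (H × (Fin (m + 1) → E)) × E → ℝ≥0∞), Measurable F →
    ∫⁻ ω, F ((X ω, fun i => Y i ω), Y (m + 1) ω) ∂μ =
      ∫⁻ ω, ∫⁻ y, F ((X ω, fun i => Y i ω), y) ∂(κ (Y m ω)) ∂μ

/-- Finite measures on `H × (ℕ → E)` are determined by their images in all `H × Eᵐ⁺¹`. -/
lemma measure_prod_path_ext {M M' : Measure (H × (ℕ → E))} [IsFiniteMeasure M]
    (h : ∀ (m : ℕ) (F : H × (Fin (m + 1) → E) → ℝ≥0∞), Measurable F →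
      ∫⁻ p, F (p.1, fun i => p.2 i) ∂M = ∫⁻ p, F (p.1, fun i => p.2 i) ∂M') : M = M' := by
  have hcyl : ∀ (S : Set H) (I : Finset ℕ) (T : Set (I → E)), MeasurableSet S →
      MeasurableSet T → M (S ×ˢ cylinder I T) = M' (S ×ˢ cylinder I T) := by
    intro S I T hS hT
    have hlt : ∀ i : I, (i : ℕ) < I.sup id + 1 := fun i =>
      Nat.lt_succ_of_le (Finset.le_sup (f := id) i.2)
    let r : (Fin (I.sup id + 1) → E) → (I → E) := fun p i => p ⟨i, hlt i⟩
    have hr : Measurable r := by fun_prop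
    have hset : MeasurableSet (S ×ˢ (r ⁻¹' T)) := hS.prod (hr hT)
    have := h (I.sup id) ((S ×ˢ (r ⁻¹' T)).indicator 1) (measurable_one.indicator hset)
    have hind : ∀ p : H × (ℕ → E),
        (S ×ˢ (r ⁻¹' T)).indicator (1 : H × (Fin (I.sup id + 1) → E) → ℝ≥0∞)
        (p.1, fun i => p.2 i) = (S ×ˢ cylinder I T).indicator 1 p := fun p => rfl
    simp only [hind] at this
    rwa [lintegral_indicator_one (hS.prod (hT.cylinder I)),
      lintegral_indicator_one (hS.prod (hT.cylinder I))] at this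
  refine ext_of_generate_finite
    (Set.image2 (· ×ˢ ·) {s : Set H | MeasurableSet s} (measurableCylinders fun _ : ℕ => E))
    ?_ (MeasurableSpace.isPiSystem_measurableSet.prod isPiSystem_measurableCylinders) ?_ ?_
  · refine (generateFrom_eq_prod (MeasurableSpace.generateFrom_measurableSet)
      generateFrom_measurableCylinders ?_ ?_).symm
    · exact ⟨fun _ => Set.univ, fun _ => MeasurableSet.univ, Set.iUnion_const _⟩
    · exact ⟨fun _ => Set.univ, fun _ => univ_mem_measurableCylinders _, Set.iUnion_const _⟩
  · rintro _ ⟨S, hS, C, hC, rfl⟩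
    obtain ⟨I, T, hT, rfl⟩ := (mem_measurableCylinders _).1 hC
    exact hcyl S I T hS hT
  · have := hcyl Set.univ ∅ Set.univ MeasurableSet.univ MeasurableSet.univ
    simpa using this

/-- The law of `(X, Y)` is determined by that of `(X, Y 0)` when `Y` is Markov after `X`. -/
lemma IsMarkovAfter.map_eq {Ω' : Type*} [MeasurableSpace Ω'] {μ' : Measure Ω'}
    [IsProbabilityMeasure μ] [IsMarkovKernel κ]
    {X : Ω → H} {Y : ℕ → Ω → E} {X' : Ω' → H} {Y' : ℕ → Ω' → E}
    (hX : Measurable X) (hY : ∀ m, Measurable (Y m)) (hX' : Measurable X')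
    (hY' : ∀ m, Measurable (Y' m)) (h : IsMarkovAfter μ X Y κ) (h' : IsMarkovAfter μ' X' Y' κ)
    (h₀ : ∀ F : H × E → ℝ≥0∞, Measurable F →
      ∫⁻ ω, F (X ω, Y 0 ω) ∂μ = ∫⁻ ω, F (X' ω, Y' 0 ω) ∂μ') :
    μ.map (fun ω => (X ω, fun j => Y j ω)) = μ'.map (fun ω => (X' ω, fun j => Y' j ω)) := by
  have hm : Measurable fun ω => (X ω, fun j => Y j ω) :=
    hX.prodMk (measurable_pi_lambda _ hY)
  have hm' : Measurable fun ω => (X' ω, fun j => Y' j ω) :=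
    hX'.prodMk (measurable_pi_lambda _ hY')
  have : IsProbabilityMeasure (μ.map (fun ω => (X ω, fun j => Y j ω))) :=
    Measure.isProbabilityMeasure_map hm.aemeasurable
  refine measure_prod_path_ext fun m F hF => ?_
  have hF' : Measurable fun p : H × (ℕ → E) => F (p.1, fun i => p.2 i) :=
    hF.comp (by fun_prop)
  rw [lintegral_map hF' hm, lintegral_map hF' hm']
  clear hF'
  induction m with
  | zero =>
    have := h₀ (fun p => F (p.1, fun _ => p.2)) (hF.comp (by fun_prop))
    convert! this using 5 with ω ω
    · funext i; rw [Fin.fin_one_eq_zero i]; rfl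
    · funext i; rw [Fin.fin_one_eq_zero i]; rfl
  | succ m ih =>
    let G : (H × (Fin (m + 1) → E)) × E → ℝ≥0∞ := fun p =>
      F (p.1.1, Fin.snoc (α := fun _ => E) p.1.2 p.2)
    have hsn : Measurable fun p : (Fin (m + 1) → E) × E =>
        (Fin.snoc (α := fun _ => E) p.1 p.2 : Fin (m + 2) → E) := by
      refine measurable_pi_lambda _ fun i => ?_
      refine Fin.lastCases ?_ (fun j => ?_) i
      · simpa using measurable_snd
      · simpa using (by fun_prop : Measurable fun c : (Fin (m + 1) → E) × E => c.1 j)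
    have hG : Measurable G := hF.comp
      (measurable_fst.fst.prodMk (hsn.comp (measurable_fst.snd.prodMk measurable_snd)))
    have hsnoc : ∀ f : ℕ → E, (fun i : Fin (m + 2) => f i) =
        Fin.snoc (α := fun _ => E) (fun i : Fin (m + 1) => f i) (f (m + 1)) := by
      intro f
      funext i
      refine Fin.lastCases ?_ (fun j => ?_) i <;> simp
    have e := h m G hG
    have e' := h' m G hG
    have hK : Measurable fun p : H × (Fin (m + 1) → E) =>
        ∫⁻ y, G (p, y) ∂(κ (p.2 (Fin.last m))) :=
      Measurable.lintegral_kernel_prod_right'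
        (κ := κ.comap (fun p : H × (Fin (m + 1) → E) => p.2 (Fin.last m)) (by fun_prop)) hG
    have := ih _ hK
    simp only [Fin.val_last] at this
    calc _ = ∫⁻ ω, G ((X ω, fun i => Y i ω), Y (m + 1) ω) ∂μ := by
          refine lintegral_congr fun ω => ?_
          simp only [G]
          rw [hsnoc fun j => Y j ω]
      _ = ∫⁻ ω, G ((X' ω, fun i => Y' i ω), Y' (m + 1) ω) ∂μ' := by rw [e, e', this]
      _ = _ := by
          refine lintegral_congr fun ω => ?_
          simp only [G]
          rw [hsnoc fun j => Y' j ω]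

/-- The law of the path of a Markov chain with kernel `κ`, as a kernel in the starting point. -/
noncomputable def pathKernel (κ : Kernel E E) [IsMarkovKernel κ] : Kernel E (ℕ → E) :=
  (Kernel.traj (X := fun _ => E) (fun n => κ.comap
    (fun h : (Π _ : Finset.Iic n, E) => h ⟨n, Finset.mem_Iic.2 le_rfl⟩) (by fun_prop)) 0).comap
      (fun x _ => x) (by fun_prop)

instance [IsMarkovKernel κ] : IsMarkovKernel (pathKernel κ) := by
  unfold pathKernel; infer_instance

lemma isMarkovChain_pathKernel [IsMarkovKernel κ] (x : E) :
    IsMarkovChain (pathKernel κ x) (fun k f => f k) (Measure.dirac x) κ where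
  measurable k := measurable_pi_apply k
  initial := by
    have hc : (fun f : ℕ → E => f 0) = (fun p : (Π _ : Finset.Iic 0, E) =>
        p ⟨0, Finset.mem_Iic.2 le_rfl⟩) ∘ Preorder.frestrictLe 0 := rfl
    rw [hc, ← Measure.map_map (by fun_prop) (by fun_prop), pathKernel, Kernel.comap_apply,
      Kernel.traj_map_frestrictLe_apply, Kernel.partialTraj_self, Kernel.id_apply,
      Measure.map_dirac' (by fun_prop)]
  step k := by
    let K : (n : ℕ) → Kernel (Π _ : Finset.Iic n, E) E := fun n => κ.comap
      (fun h : (Π _ : Finset.Iic n, E) => h ⟨n, Finset.mem_Iic.2 le_rfl⟩) (by fun_prop)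
    have hP : pathKernel κ x = Kernel.trajMeasure (X := fun _ => E) (Measure.dirac x) K := by
      rw [Kernel.trajMeasure, Measure.map_dirac' (MeasurableEquiv.measurable _),
        Measure.dirac_bind (by fun_prop)]
      rfl
    have hs := Kernel.map_frestrictLe_trajMeasure_compProd_eq_map_trajMeasure
      (X := fun _ => E) (μ₀ := Measure.dirac x) (κ := K) (a := k)
    rw [← hP] at hs
    let r : (Π _ : Finset.Iic k, E) → (Fin (k + 1) → E) := fun p i =>
      p ⟨i, Finset.mem_Iic.2 (Nat.le_of_lt_succ i.2)⟩
    have hr : Measurable r := by fun_prop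
    have h1 : (fun f : ℕ → E => ((fun i : Fin (k + 1) => f i), f (k + 1))) =
        (Prod.map r id) ∘ fun f : ℕ → E =>
          (Preorder.frestrictLe (π := fun _ => E) k f, f (k + 1)) := rfl
    have h2 : (fun f : ℕ → E => fun i : Fin (k + 1) => f i) =
        r ∘ Preorder.frestrictLe (π := fun _ => E) k := rfl
    have hfr : Measurable (Preorder.frestrictLe (π := fun _ : ℕ => E) k) := by fun_prop
    rw [h1, ← Measure.map_map (by fun_prop) (by fun_prop), ← hs, h2]
    rw [← Measure.map_map hr hfr]
    have : IsProbabilityMeasure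
        (Measure.map (Preorder.frestrictLe (π := fun _ : ℕ => E) k) (pathKernel κ x)) :=
      Measure.isProbabilityMeasure_map hfr.aemeasurable
    have : IsProbabilityMeasure (Measure.map r
        (Measure.map (Preorder.frestrictLe (π := fun _ : ℕ => E) k) (pathKernel κ x))) :=
      Measure.isProbabilityMeasure_map hr.aemeasurable
    refine Measure.ext_of_lintegral _ fun F hF => ?_
    rw [lintegral_map hF (by fun_prop),
      Measure.lintegral_compProd (f := fun p => F (Prod.map r id p))
        (hF.comp (by fun_prop)), Measure.lintegral_compProd hF,
      lintegral_map hF.lintegral_kernel_prod_right' hr]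
    rfl

end MarkovProperty

lemma IsMarkovChain.isProbabilityMeasure {Ω E : Type*} [MeasurableSpace Ω] [MeasurableSpace E]
    {μ : Measure Ω} [IsProbabilityMeasure μ] {κ : Kernel E E} {Z : ℕ → Ω → E} {ν : Measure E}
    (hZ : IsMarkovChain μ Z ν κ) : IsProbabilityMeasure ν :=
  hZ.initial ▸ Measure.isProbabilityMeasure_map (hZ.measurable 0).aemeasurable

section MarkovProperty

variable {Ω E H : Type*} [MeasurableSpace Ω] [MeasurableSpace E] [MeasurableSpace H]
  {μ : Measure Ω} [IsProbabilityMeasure μ] {κ : Kernel E E} [IsMarkovKernel κ]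

/-- A sequence that is Markov after `X` is distributed, given `X` and its starting point, as the
path kernel. -/
lemma IsMarkovAfter.lintegral_path {X : Ω → H} {Y : ℕ → Ω → E} (hX : Measurable X)
    (hY : ∀ m, Measurable (Y m)) (h : IsMarkovAfter μ X Y κ) {F : H × (ℕ → E) → ℝ≥0∞}
    (hF : Measurable F) :
    ∫⁻ ω, F (X ω, fun j => Y j ω) ∂μ =
      ∫⁻ ω, ∫⁻ f, F (X ω, f) ∂(pathKernel κ (Y 0 ω)) ∂μ := by
  have hXY : Measurable fun ω => (X ω, Y 0 ω) := hX.prodMk (hY 0)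
  have : IsProbabilityMeasure (μ.map fun ω => (X ω, Y 0 ω)) :=
    Measure.isProbabilityMeasure_map hXY.aemeasurable
  let Ψ : Kernel (H × E) (ℕ → E) := (pathKernel κ).comap Prod.snd measurable_snd
  have hlint : ∀ G : (H × E) × (ℕ → E) → ℝ≥0∞, Measurable G →
      ∫⁻ p, G p ∂((μ.map fun ω => (X ω, Y 0 ω)) ⊗ₘ Ψ) =
        ∫⁻ ω, ∫⁻ f, G ((X ω, Y 0 ω), f) ∂(pathKernel κ (Y 0 ω)) ∂μ := by
    intro G hG
    rw [Measure.lintegral_compProd hG, lintegral_map hG.lintegral_kernel_prod_right' hXY]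
    rfl
  have hK : ∀ (m : ℕ) (G : (H × (Fin (m + 1) → E)) × E → ℝ≥0∞), Measurable G →
      Measurable fun p : H × (Fin (m + 1) → E) => ∫⁻ y, G (p, y) ∂(κ (p.2 (Fin.last m))) :=
    fun m G hG => Measurable.lintegral_kernel_prod_right'
      (κ := κ.comap (fun p : H × (Fin (m + 1) → E) => p.2 (Fin.last m)) (by fun_prop)) hG
  have h' : IsMarkovAfter ((μ.map fun ω => (X ω, Y 0 ω)) ⊗ₘ Ψ)
      (fun p => p.1.1) (fun j p => p.2 j) κ := by
    intro m G hG
    have e1 := hlint (fun p => G ((p.1.1, fun i => p.2 i), p.2 (m + 1))) (hG.comp (by fun_prop))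
    have e2 := hlint (fun p => ∫⁻ y, G ((p.1.1, fun i => p.2 i), y) ∂(κ (p.2 m)))
      ((hK m G hG).comp (by fun_prop :
        Measurable fun p : (H × E) × (ℕ → E) => (p.1.1, fun i : Fin (m + 1) => p.2 i)))
    rw [e1, e2]
    refine lintegral_congr fun ω => ?_
    exact (isMarkovChain_pathKernel (κ := κ) (Y 0 ω)).lintegral_step m
      (F := fun q => G ((X ω, q.1), q.2)) (hG.comp (by fun_prop))
  have hmap := IsMarkovAfter.map_eq hX hY (measurable_fst.fst)
    (fun m => (measurable_pi_apply m).comp measurable_snd) h h' (fun G hG => by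
      have e1 := hlint (fun p => G (p.1.1, p.2 0)) (hG.comp (by fun_prop))
      simp only at e1 ⊢
      rw [e1]
      refine lintegral_congr fun ω => ?_
      have hG' : Measurable fun y => G (X ω, y) := hG.comp (by fun_prop)
      rw [← lintegral_map (μ := pathKernel κ (Y 0 ω)) hG' (measurable_pi_apply 0),
        (isMarkovChain_pathKernel (κ := κ) (Y 0 ω)).initial, lintegral_dirac' _ hG'])
  have hl := lintegral_map (μ := μ) hF (hX.prodMk (measurable_pi_lambda _ hY))
  rw [hmap, lintegral_map hF (by fun_prop)] at hl
  have e := hlint (fun p => F (p.1.1, p.2)) (hF.comp (by fun_prop))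
  exact hl.symm.trans e

variable {Z : ℕ → Ω → E} {ν : Measure E}

/-- The chain from time `k` on is Markov after any observation of its past up to time `k`. -/
lemma IsMarkovChain.isMarkovAfter (hZ : IsMarkovChain μ Z ν κ) (k : ℕ)
    {g : (Fin (k + 1) → E) → H} (hg : Measurable g) :
    IsMarkovAfter μ (fun ω => g fun i => Z i ω) (fun j => Z (k + j)) κ := by
  intro m F hF
  let r : (Fin (k + m + 1) → E) → H × (Fin (m + 1) → E) := fun p =>
    (g fun i => p ⟨i, by omega⟩, fun i => p ⟨k + i, by omega⟩)
  have hr : Measurable r := (hg.comp (by fun_prop)).prodMk (by fun_prop)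
  exact hZ.lintegral_step (k + m) (F := fun p => F (r p.1, p.2))
    (hF.comp ((hr.comp measurable_fst).prodMk measurable_snd))

/-- The Markov property at time `k`, for the whole future. -/
lemma IsMarkovChain.lintegral_path (hZ : IsMarkovChain μ Z ν κ) (k : ℕ)
    {g : (Fin (k + 1) → E) → H} (hg : Measurable g) {F : H × (ℕ → E) → ℝ≥0∞}
    (hF : Measurable F) :
    ∫⁻ ω, F (g fun i => Z i ω, fun j => Z (k + j) ω) ∂μ =
      ∫⁻ ω, ∫⁻ f, F (g fun i => Z i ω, f) ∂(pathKernel κ (Z k ω)) ∂μ :=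
  (hZ.isMarkovAfter k hg).lintegral_path
    (hg.comp (measurable_pi_lambda _ fun i => hZ.measurable i)) (fun _ => hZ.measurable _) hF

lemma IsMarkovChain.map_eq_bind (hZ : IsMarkovChain μ Z ν κ) (k : ℕ) :
    μ.map (Z k) = ν.bind (κ ^ k) := by
  induction k with
  | zero =>
    rw [hZ.initial]
    exact (Measure.bind_dirac (m := ν)).symm
  | succ k ih =>
    have e : ν.bind (κ ^ (k + 1)) = (ν.bind (κ ^ k)).bind κ := by
      rw [pow_succ']
      exact Measure.comp_assoc.symm
    rw [e, ← ih]
    ext A hA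
    have := hZ.lintegral_step k (F := fun p => A.indicator 1 p.2)
      ((measurable_one.indicator hA).comp measurable_snd)
    rw [Measure.bind_apply hA κ.aemeasurable,
      lintegral_map (Kernel.measurable_coe _ hA) (hZ.measurable k),
      ← lintegral_indicator_one hA, lintegral_map (measurable_one.indicator hA) (hZ.measurable _),
      this]
    exact lintegral_congr fun ω => lintegral_indicator_one hA

lemma pathKernel_map_eval (x : E) (k : ℕ) : (pathKernel κ x).map (fun f => f k) = (κ ^ k) x := by
  rw [(isMarkovChain_pathKernel (κ := κ) x).map_eq_bind k]
  exact Measure.dirac_bind (Kernel.measurable _) x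

/-- The Markov property at time `k`, for the state `t` steps later. -/
lemma IsMarkovChain.lintegral_pow (hZ : IsMarkovChain μ Z ν κ) (k t : ℕ)
    {F : (Fin (k + 1) → E) × E → ℝ≥0∞} (hF : Measurable F) :
    ∫⁻ ω, F (fun i : Fin (k + 1) => Z i ω, Z (k + t) ω) ∂μ =
      ∫⁻ ω, ∫⁻ y, F (fun i : Fin (k + 1) => Z i ω, y) ∂((κ ^ t) (Z k ω)) ∂μ := by
  have := hZ.lintegral_path k (g := id) measurable_id (F := fun p => F (p.1, p.2 t))
    (hF.comp (by fun_prop))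
  simp only [id] at this
  rw [this]
  refine lintegral_congr fun ω => ?_
  have hF' : Measurable fun y => F (fun i : Fin (k + 1) => Z i ω, y) := hF.comp (by fun_prop)
  rw [← pathKernel_map_eval, lintegral_map hF' (measurable_pi_apply t)]

lemma IsMarkovChain.integral_pow (hZ : IsMarkovChain μ Z ν κ) (k t : ℕ) {h : E → ℝ}
    (hh : Measurable h) {c : ℝ} (hc : ∀ x y, h x - h y ≤ c) :
    ∫ ω, h (Z (k + t) ω) ∂μ = ∫ ω, ∫ y, h y ∂((κ ^ t) (Z k ω)) ∂μ := by
  have := hZ.isProbabilityMeasure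
  have e : μ.map (Z (k + t)) = (μ.map (Z k)).bind (κ ^ t) := by
    rw [hZ.map_eq_bind, hZ.map_eq_bind, add_comm, pow_add]
    exact Measure.comp_assoc.symm
  have : IsProbabilityMeasure (μ.map (Z (k + t))) :=
    Measure.isProbabilityMeasure_map (hZ.measurable _).aemeasurable
  have hi : Integrable h (((κ ^ t) ∘ₖ Kernel.const Unit (μ.map (Z k))) ()) := by
    rw [Kernel.comp_apply, Kernel.const_apply, ← e]
    exact integrable_of_osc_le hh hc _
  have hint := Kernel.integral_comp hi
  rw [Kernel.comp_apply, Kernel.const_apply, ← e,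
    integral_map (hZ.measurable _).aemeasurable hh.aestronglyMeasurable,
    integral_map (hZ.measurable _).aemeasurable
      (hh.stronglyMeasurable.integral_kernel (κ := κ ^ t)).aestronglyMeasurable] at hint
  exact hint

end MarkovProperty

/-! ### Concentration of additive functionals -/

section Concentration

variable {Ω E : Type*} [MeasurableSpace Ω] [MeasurableSpace E]
  {μ : Measure Ω} [IsProbabilityMeasure μ]

/-- **Hoeffding's lemma** for a function of oscillation at most `2`. -/
lemma lintegral_exp_le_of_osc_le (P : Measure E) [IsProbabilityMeasure P] {h : E → ℝ}
    (hh : Measurable h) (hc : ∀ x y, h x - h y ≤ 2) (l : ℝ) :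
    ∫⁻ x, ENNReal.ofReal (Real.exp (l * h x)) ∂P ≤
      ENNReal.ofReal (Real.exp (l * ∫ x, h x ∂P + l ^ 2 / 2)) := by
  have : Nonempty E := P.nonempty_of_neZero
  obtain ⟨a, ha⟩ := exists_forall_mem_Icc_of_osc_le hc
  have hs := hasSubgaussianMGF_of_mem_Icc (μ := P) hh.aemeasurable (ae_of_all _ ha)
  have hm := hs.mgf_le l
  have hi := hs.integrable_exp_mul l
  have hpar : (((‖a + 2 - a‖₊ / 2) ^ 2 : NNReal) : ℝ) = 1 := by
    rw [add_sub_cancel_left]; simp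
  rw [mgf, hpar] at hm
  have hsplit : ∀ x, Real.exp (l * h x) =
      Real.exp (l * ∫ x, h x ∂P) * Real.exp (l * (h x - ∫ x, h x ∂P)) := by
    intro x; rw [← Real.exp_add]; ring_nf
  simp_rw [hsplit]
  rw [← ofReal_integral_eq_lintegral_ofReal (hi.const_mul _)
    (ae_of_all _ fun x => by positivity), integral_const_mul, Real.exp_add]
  gcongr
  simpa using hm

lemma IsMarkovChain.integrable_comp {κ : Kernel E E} {Z : ℕ → Ω → E} {ν : Measure E}
    (hZ : IsMarkovChain μ Z ν κ) {g : E → ℝ}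
    (hg : Measurable g) {c : ℝ} (hc : ∀ x y, g x - g y ≤ c) (k : ℕ) :
    Integrable (fun ω => g (Z k ω)) μ :=
  integrable_of_osc_le (f := fun ω => g (Z k ω)) (hg.comp (hZ.measurable k))
    (fun _ _ => hc _ _) μ

variable {κ : Kernel E E} [IsMarkovKernel κ] {Z : ℕ → Ω → E} {ν : Measure E}

/-- Exponential moments along a subsequence of time step `t`. The terminal function `h`, of
oscillation at most `2`, absorbs the conditional mean of all later terms: as `κ ^ t` halves
oscillations, `g + κ ^ t h` again has oscillation at most `1 + 2 / 2`. -/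
lemma IsMarkovChain.lintegral_exp_sum_le (hZ : IsMarkovChain μ Z ν κ) {t : ℕ}
    (hκ : HalvesOscillation (κ ^ t)) {g : E → ℝ} (hg : Measurable g)
    (hgc : ∀ x y, g x - g y ≤ 1) (j : ℕ) (l : ℝ) (m : ℕ) :
    ∀ h : E → ℝ, Measurable h → (∀ x y, h x - h y ≤ 2) →
      ∫⁻ ω, ENNReal.ofReal (Real.exp (l * (∑ i ∈ Finset.range m, g (Z (j + i * t) ω) +
        h (Z (j + m * t) ω)))) ∂μ ≤
      ENNReal.ofReal (Real.exp (l * (∑ i ∈ Finset.range m, ∫ ω, g (Z (j + i * t) ω) ∂μ +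
        ∫ ω, h (Z (j + m * t) ω) ∂μ) + (m + 1) * (l ^ 2 / 2))) := by
  induction m with
  | zero =>
    intro h hh hc
    have : IsProbabilityMeasure (μ.map (Z j)) :=
      Measure.isProbabilityMeasure_map (hZ.measurable _).aemeasurable
    have := lintegral_exp_le_of_osc_le (μ.map (Z j)) hh hc l
    rw [lintegral_map (by fun_prop) (hZ.measurable _),
      integral_map (hZ.measurable _).aemeasurable hh.aestronglyMeasurable] at this
    simpa using this
  | succ m ih =>
    intro h hh hc
    set k := j + m * t with hk
    have hkt : j + (m + 1) * t = k + t := by rw [hk]; ring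
    let h' : E → ℝ := fun x => g x + ∫ y, h y ∂((κ ^ t) x)
    have hKh : Measurable fun x => ∫ y, h y ∂((κ ^ t) x) :=
      (hh.stronglyMeasurable.integral_kernel (κ := κ ^ t)).measurable
    have hKc : ∀ x y, ∫ z, h z ∂((κ ^ t) x) - ∫ z, h z ∂((κ ^ t) y) ≤ 1 := fun x y => by
      have := hκ.integral_sub_le hh hc x y
      linarith
    have hh' : Measurable h' := hg.add hKh
    have hc' : ∀ x y, h' x - h' y ≤ 2 := fun x y => by
      have h1 := hKc x y
      have h2 := hgc x y
      simp only [h']; linarith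
    have hmean : ∫ ω, h' (Z k ω) ∂μ = ∫ ω, g (Z k ω) ∂μ + ∫ ω, h (Z (k + t) ω) ∂μ := by
      rw [hZ.integral_pow k t hh hc]
      exact integral_add (hZ.integrable_comp hg hgc k) (hZ.integrable_comp hKh hKc k)
    have hidx : ∀ i ∈ Finset.range (m + 1), j + i * t < k + 1 := fun i hi => by
      have : i * t ≤ m * t := Nat.mul_le_mul_right t (Nat.lt_succ_iff.1 (Finset.mem_range.1 hi))
      omega
    let A : (Fin (k + 1) → E) → ℝ := fun p =>
      ∑ i ∈ (Finset.range (m + 1)).attach, g (p ⟨j + i.1 * t, hidx i.1 i.2⟩)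
    have hA : Measurable A := Finset.measurable_fun_sum _ fun i _ => hg.comp (by fun_prop)
    have hAeq : ∀ ω, A (fun i => Z i ω) = ∑ i ∈ Finset.range (m + 1), g (Z (j + i * t) ω) :=
      fun ω => Finset.sum_attach (Finset.range (m + 1)) fun i => g (Z (j + i * t) ω)
    have hstep := hZ.lintegral_pow k t
      (F := fun p => ENNReal.ofReal (Real.exp (l * (A p.1 + h p.2)))) (by fun_prop)
    simp only [hAeq] at hstep
    rw [hkt, hstep]
    calc _ ≤ ∫⁻ ω, ENNReal.ofReal (Real.exp (l ^ 2 / 2)) *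
          ENNReal.ofReal (Real.exp (l * (∑ i ∈ Finset.range m, g (Z (j + i * t) ω) +
            h' (Z k ω)))) ∂μ := by
          refine lintegral_mono fun ω => ?_
          simp only [mul_add l, Real.exp_add, ENNReal.ofReal_mul (Real.exp_pos _).le]
          rw [lintegral_const_mul _ (by fun_prop)]
          refine (mul_le_mul_right (lintegral_exp_le_of_osc_le _ hh hc l) _).trans (le_of_eq ?_)
          simp only [← ENNReal.ofReal_mul (Real.exp_pos _).le, ← Real.exp_add, h']
          rw [Finset.sum_range_succ, ← hk]
          congr 2
          ring
      _ = ENNReal.ofReal (Real.exp (l ^ 2 / 2)) * ∫⁻ ω, ENNReal.ofReal (Real.exp (l *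
          (∑ i ∈ Finset.range m, g (Z (j + i * t) ω) + h' (Z k ω)))) ∂μ := by
          refine lintegral_const_mul' _ _ ENNReal.ofReal_ne_top
      _ ≤ _ := by
          refine (mul_le_mul_right (ih h' hh' hc') _).trans (le_of_eq ?_)
          rw [← ENNReal.ofReal_mul (Real.exp_pos _).le, ← Real.exp_add, hmean,
            Finset.sum_range_succ, ← hk]
          push_cast
          congr 2
          ring

/-- Along a subsequence of time step `t`, a centred sum is sub-Gaussian with its number of terms as
variance proxy. The last term plays the role of the terminal function. -/
lemma IsMarkovChain.hasSubgaussianMGF_subsequence (hZ : IsMarkovChain μ Z ν κ) {t : ℕ}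
    (hκ : HalvesOscillation (κ ^ t)) {g : E → ℝ} (hg : Measurable g)
    (hgc : ∀ x y, g x - g y ≤ 1) (j m : ℕ) :
    HasSubgaussianMGF (fun ω => ∑ i ∈ Finset.range m,
      (g (Z (j + i * t) ω) - ∫ ω, g (Z (j + i * t) ω) ∂μ)) m μ := by
  cases m with
  | zero => simp
  | succ m =>
    have key : ∀ l : ℝ, ∫⁻ ω, ENNReal.ofReal (Real.exp (l * ∑ i ∈ Finset.range (m + 1),
        (g (Z (j + i * t) ω) - ∫ ω, g (Z (j + i * t) ω) ∂μ))) ∂μ ≤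
        ENNReal.ofReal (Real.exp ((m + 1) * (l ^ 2 / 2))) := by
      intro l
      have h := hZ.lintegral_exp_sum_le hκ hg hgc j l m g hg
        (fun x y => (hgc x y).trans one_le_two)
      simp only [← Finset.sum_range_succ (fun i => g (Z (j + i * t) _)),
        ← Finset.sum_range_succ (fun i => ∫ ω, g (Z (j + i * t) ω) ∂μ)] at h
      set M := ∑ i ∈ Finset.range (m + 1), ∫ ω, g (Z (j + i * t) ω) ∂μ
      have e : ∀ ω, ENNReal.ofReal (Real.exp (l * ∑ i ∈ Finset.range (m + 1),
          (g (Z (j + i * t) ω) - ∫ ω, g (Z (j + i * t) ω) ∂μ))) =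
          ENNReal.ofReal (Real.exp (-(l * M))) * ENNReal.ofReal (Real.exp (l *
            ∑ i ∈ Finset.range (m + 1), g (Z (j + i * t) ω))) := by
        intro ω
        rw [← ENNReal.ofReal_mul (Real.exp_pos _).le, ← Real.exp_add, Finset.sum_sub_distrib]
        congr 2
        ring
      simp_rw [e]
      rw [lintegral_const_mul' _ _ ENNReal.ofReal_ne_top]
      refine (mul_le_mul_right h _).trans (le_of_eq ?_)
      rw [← ENNReal.ofReal_mul (Real.exp_pos _).le, ← Real.exp_add]
      congr 2
      ring
    have hmeas : Measurable fun ω => ∑ i ∈ Finset.range (m + 1),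
        (g (Z (j + i * t) ω) - ∫ ω, g (Z (j + i * t) ω) ∂μ) :=
      Finset.measurable_fun_sum _ fun i _ => (hg.comp (hZ.measurable _)).sub_const _
    have hexp : ∀ l : ℝ, AEStronglyMeasurable (fun ω => Real.exp (l *
        ∑ i ∈ Finset.range (m + 1), (g (Z (j + i * t) ω) - ∫ ω, g (Z (j + i * t) ω) ∂μ))) μ :=
      fun l => (Real.measurable_exp.comp (hmeas.const_mul l)).aestronglyMeasurable
    refine ⟨fun l => ⟨hexp l, ?_⟩, fun l => ?_⟩
    · rw [hasFiniteIntegral_iff_ofReal (ae_of_all _ fun ω => (Real.exp_pos _).le)]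
      exact (key l).trans_lt ENNReal.ofReal_lt_top
    · rw [mgf, integral_eq_lintegral_of_nonneg_ae (ae_of_all _ fun ω => (Real.exp_pos _).le)
        (hexp l)]
      refine ENNReal.toReal_le_of_le_ofReal (Real.exp_pos _).le ((key l).trans (le_of_eq ?_))
      push_cast
      ring_nf

/-- Standard deviations of dependent sub-Gaussian variables add up. -/
lemma hasSubgaussianMGF_sum {ι : Type*} (s : Finset ι) (X : ι → Ω → ℝ) (c : ι → NNReal)
    (h : ∀ i ∈ s, HasSubgaussianMGF (X i) (c i) μ) :
    HasSubgaussianMGF (fun ω => ∑ i ∈ s, X i ω) ((∑ i ∈ s, (c i).sqrt) ^ 2) μ := by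
  classical
  induction s using Finset.induction_on with
  | empty => simp
  | insert a s ha ih =>
    simp only [Finset.sum_insert ha]
    have := (h a (Finset.mem_insert_self a s)).add
      (ih fun i hi => h i (Finset.mem_insert_of_mem hi))
    rwa [NNReal.sqrt_sq] at this

/-- Summation over `0, …, n - 1` by residue classes modulo `t`. -/
lemma sum_range_eq_sum_residues (F : ℕ → ℝ) {t : ℕ} (ht : 1 ≤ t) (n : ℕ) :
    ∑ i ∈ Finset.range n, F i =
      ∑ j ∈ Finset.range t, ∑ l ∈ Finset.range ((n + t - 1 - j) / t), F (j + l * t) := by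
  have hmem : ∀ j l : ℕ, j < t → (l < (n + t - 1 - j) / t ↔ j + l * t < n) := fun j l hj => by
    rw [← Nat.succ_le_iff, Nat.le_div_iff_mul_le (by omega), Nat.succ_mul]
    omega
  rw [Finset.sum_sigma']
  refine Finset.sum_bij' (fun i _ => ⟨i % t, i / t⟩) (fun p _ => p.1 + p.2 * t) ?_ ?_ ?_ ?_ ?_
  · intro i hi
    have hlt : i % t < t := Nat.mod_lt _ (by omega)
    simp only [Finset.mem_sigma, Finset.mem_range] at hi ⊢
    exact ⟨hlt, (hmem _ _ hlt).2 (by rwa [mul_comm, Nat.mod_add_div])⟩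
  · rintro ⟨j, l⟩ h
    simp only [Finset.mem_sigma, Finset.mem_range] at h ⊢
    exact (hmem j l h.1).1 h.2
  · intro i _
    simp only [mul_comm _ t, Nat.mod_add_div]
  · rintro ⟨j, l⟩ h
    simp only [Finset.mem_sigma, Finset.mem_range] at h
    simp [Nat.add_mul_mod_self_right, Nat.mod_eq_of_lt h.1,
      Nat.add_mul_div_right _ _ (by omega : 0 < t), Nat.div_eq_of_lt h.1]
  · intro i _
    simp only [mul_comm _ t, Nat.mod_add_div]

/-- A Hoeffding inequality for Markov chains: the sum is split into `t` subsequences with time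
step `t`, each sub-Gaussian with its number of terms as variance proxy; by the Cauchy-Schwarz
inequality, their sum has variance proxy at most `t * n`. -/
lemma IsMarkovChain.measureReal_sum_ge_le (hZ : IsMarkovChain μ Z ν κ) {t : ℕ} (ht : 1 ≤ t)
    (hκ : HalvesOscillation (κ ^ t)) {g : E → ℝ} (hg : Measurable g)
    (hgc : ∀ x y, g x - g y ≤ 1) {n : ℕ} (hn : 1 ≤ n) {u : ℝ} (hu : 0 ≤ u) :
    μ.real {ω | n * u ≤ ∑ i ∈ Finset.range n,
      (g (Z (i + 1) ω) - ∫ ω, g (Z (i + 1) ω) ∂μ)} ≤ Real.exp (-(n * u ^ 2 / (2 * t))) := by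
  let m : ℕ → ℕ := fun j => (n + t - 1 - j) / t
  have h1 := hasSubgaussianMGF_sum (Finset.range t) (fun j ω => ∑ l ∈ Finset.range (m j),
      (g (Z (j + 1 + l * t) ω) - ∫ ω, g (Z (j + 1 + l * t) ω) ∂μ)) (fun j => (m j : NNReal))
    fun j _ => hZ.hasSubgaussianMGF_subsequence hκ hg hgc (j + 1) (m j)
  have hsum : ∑ j ∈ Finset.range t, (m j : ℝ) = n := by
    have := sum_range_eq_sum_residues (fun _ => 1) ht n
    simpa using this.symm
  have hc : (((∑ j ∈ Finset.range t, NNReal.sqrt (m j : NNReal)) ^ 2 : NNReal) : ℝ) ≤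
      ((t * n : ℕ) : NNReal) := by
    push_cast
    refine sq_sum_le_card_mul_sum_sq.trans (le_of_eq ?_)
    simp only [Real.sq_sqrt (Nat.cast_nonneg _), hsum, Finset.card_range]
  have h2 : HasSubgaussianMGF (fun ω => ∑ i ∈ Finset.range n,
      (g (Z (i + 1) ω) - ∫ ω, g (Z (i + 1) ω) ∂μ)) ((t * n : ℕ) : NNReal) μ := by
    have e : (fun ω => ∑ i ∈ Finset.range n, (g (Z (i + 1) ω) - ∫ ω, g (Z (i + 1) ω) ∂μ)) =
        fun ω => ∑ j ∈ Finset.range t, ∑ l ∈ Finset.range (m j),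
          (g (Z (j + 1 + l * t) ω) - ∫ ω, g (Z (j + 1 + l * t) ω) ∂μ) := by
      funext ω
      rw [sum_range_eq_sum_residues _ ht n]
      simp only [add_right_comm, m]
    rw [e]
    refine ⟨h1.integrable_exp_mul, fun l => (h1.mgf_le l).trans ?_⟩
    gcongr
  have h3 := h2.measure_ge_le (ε := n * u) (by positivity)
  refine h3.trans (le_of_eq ?_)
  have hn' : (n : ℝ) ≠ 0 := by positivity
  have ht' : (t : ℝ) ≠ 0 := by positivity
  congr 1
  push_cast
  field_simp

end Concentration

/-! ### Quantiles -/

/-- A score is at most the conformal quantile iff fewer than `⌈(n + 1)(1 - α)⌉` calibration scores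
are smaller. -/
lemma le_conformalQuantile_iff (α : ℝ) {n : ℕ} (S : Fin n → ℝ) (a : ℝ) :
    (a : EReal) ≤ conformalQuantile α S ↔
      (Finset.univ.filter fun i => S i < a).card < ⌈((n : ℝ) + 1) * (1 - α)⌉₊ := by
  constructor
  · intro h
    by_contra! hk
    let q : EReal := (Finset.univ.filter fun i => S i < a).sup fun i => ((S i : ℝ) : EReal)
    have hq : q < a := by
      refine (Finset.sup_lt_iff (EReal.bot_lt_coe a)).2 fun i hi => ?_
      exact EReal.coe_lt_coe_iff.2 (Finset.mem_filter.1 hi).2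
    refine absurd (h.trans (sInf_le ?_)) (not_le.2 hq)
    refine hk.trans (Finset.card_le_card fun i hi => ?_)
    exact Finset.mem_filter.2 ⟨Finset.mem_univ i,
      Finset.le_sup (f := fun i => ((S i : ℝ) : EReal)) hi⟩
  · intro h
    refine le_sInf fun q hq => ?_
    by_contra! hlt
    refine absurd h (not_lt.2 (hq.trans (Finset.card_le_card fun i hi => ?_)))
    exact Finset.mem_filter.2 ⟨Finset.mem_univ i,
      EReal.coe_lt_coe_iff.1 ((Finset.mem_filter.1 hi).2.trans_lt hlt)⟩

lemma measurableSet_le_conformalQuantile {Ω : Type*} [MeasurableSpace Ω] (α : ℝ) {n : ℕ}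
    {S : Fin n → Ω → ℝ} {a : Ω → ℝ} (hS : ∀ i, Measurable (S i)) (ha : Measurable a) :
    MeasurableSet {ω | (a ω : EReal) ≤ conformalQuantile α fun i => S i ω} := by
  simp only [le_conformalQuantile_iff, Finset.card_filter]
  refine measurableSet_lt (Finset.measurable_fun_sum _ fun i _ => ?_) measurable_const
  exact Measurable.ite (measurableSet_lt (hS i) ha) measurable_const measurable_const

/-- Every `p ∈ (0, 1)` is the level of some quantile. -/
lemma exists_quantile {E : Type*} [MeasurableSpace E] (π : Measure E) [IsProbabilityMeasure π]
    {h : E → ℝ} (hh : Measurable h) {p : ℝ} (hp0 : 0 < p) (hp1 : p < 1) :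
    ∃ q : ℝ, π.real {x | h x < q} ≤ p ∧ p ≤ π.real {x | h x ≤ q} := by
  have : IsProbabilityMeasure (π.map h) := Measure.isProbabilityMeasure_map hh.aemeasurable
  set F := cdf (π.map h) with hF
  have hFr : ∀ x, F x = π.real {y | h y ≤ x} := fun x => by
    rw [hF, cdf_eq_real, map_measureReal_apply hh measurableSet_Iic]; rfl
  let T : Set ℝ := {t | p ≤ F t}
  have hne : T.Nonempty :=
    ((tendsto_cdf_atTop (π.map h)).eventually (eventually_ge_nhds hp1)).exists
  obtain ⟨t₀, ht₀⟩ := ((tendsto_cdf_atBot (π.map h)).eventually (eventually_lt_nhds hp0)).exists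
  have hbdd : BddBelow T := ⟨t₀, fun t (ht : p ≤ F t) => by
    by_contra! hlt
    exact absurd (ht.trans (monotone_cdf _ hlt.le)) (not_le.2 ht₀)⟩
  refine ⟨sInf T, ?_, ?_⟩
  · have h1 : π.real {x | h x < sInf T} = Function.leftLim F (sInf T) := by
      have h2 : π.real {x | h x < sInf T} = (π.map h).real (Set.Iio (sInf T)) := by
        rw [map_measureReal_apply hh measurableSet_Iio]; rfl
      have h3 := F.measure_Iio (tendsto_cdf_atBot (π.map h)) (sInf T)
      rw [measure_cdf] at h3
      rw [h2, measureReal_def, h3, sub_zero, ENNReal.toReal_ofReal]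
      exact (cdf_nonneg (π.map h) (sInf T - 1)).trans
        (F.mono.le_leftLim (by linarith))
    rw [h1]
    refine le_of_tendsto (F.mono.tendsto_leftLim _) ?_
    filter_upwards [self_mem_nhdsWithin] with t ht
    by_contra! hlt
    exact absurd (csInf_le hbdd (show t ∈ T from hlt.le)) (not_le.2 ht)
  · rw [← hFr]
    have hr : Filter.Tendsto F (nhdsWithin (sInf T) (Set.Ioi (sInf T))) (nhds (F (sInf T))) :=
      (F.right_continuous (sInf T)).tendsto.mono_left (nhdsWithin_mono _ Set.Ioi_subset_Ici_self)
    refine ge_of_tendsto hr ?_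
    filter_upwards [self_mem_nhdsWithin] with t ht
    obtain ⟨s, hs, hst⟩ := exists_lt_of_csInf_lt hne ht
    exact le_trans hs (monotone_cdf _ hst.le)

/-! ### Coverage for a fixed score function -/

section Coverage

variable {Ω E : Type*} [MeasurableSpace Ω] [MeasurableSpace E]
  {μ : Measure Ω} [IsProbabilityMeasure μ] {κ : Kernel E E} [IsMarkovKernel κ]
  {Z : ℕ → Ω → E} {ν π : Measure E} [IsProbabilityMeasure π]

lemma IsMarkovChain.abs_measureReal_preimage_sub_le (hZ : IsMarkovChain μ Z ν κ) (k : ℕ)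
    {B : Set E} (hB : MeasurableSet B) :
    |μ.real (Z k ⁻¹' B) - π.real B| ≤ tvToStationary κ ν π k := by
  have := hZ.isProbabilityMeasure
  have : IsProbabilityMeasure (ν.bind (κ ^ k)) := by
    rw [← hZ.map_eq_bind]
    exact Measure.isProbabilityMeasure_map (hZ.measurable k).aemeasurable
  rw [← map_measureReal_apply (hZ.measurable k) hB, hZ.map_eq_bind]
  exact abs_measureReal_sub_le_tvDist _ _ hB

/-- The average distance to stationarity of the calibration points, `n⁻¹ ∑ᵢ ‖ν κⁱ - π‖` over
`1 ≤ i ≤ n`. -/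
noncomputable def meanBias (κ : Kernel E E) (ν π : Measure E) (n : ℕ) : ℝ :=
  1 / n * ∑ i ∈ Finset.Icc 1 n, tvToStationary κ ν π i

lemma IsMarkovChain.abs_sum_measureReal_sub_le (hZ : IsMarkovChain μ Z ν κ) {n : ℕ}
    (hn : 1 ≤ n) {B : Set E} (hB : MeasurableSet B) :
    |∑ i ∈ Finset.range n, μ.real (Z (i + 1) ⁻¹' B) - n * π.real B| ≤
      n * meanBias κ ν π n := by
  have hn' : (n : ℝ) ≠ 0 := by positivity
  have e1 : (n : ℝ) * π.real B = ∑ _i ∈ Finset.range n, π.real B := by simp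
  have e2 : n * meanBias κ ν π n = ∑ i ∈ Finset.range n, tvToStationary κ ν π (i + 1) := by
    rw [meanBias, ← mul_assoc, mul_one_div_cancel hn', one_mul, Finset.range_eq_Ico,
      Finset.sum_Ico_add' (fun i => tvToStationary κ ν π i) 0 n 1]
    rfl
  rw [e1, e2, ← Finset.sum_sub_distrib]
  exact (Finset.abs_sum_le_sum_abs _ _).trans
    (Finset.sum_le_sum fun i _ => hZ.abs_measureReal_preimage_sub_le (i + 1) hB)

/-- Upper deviations of the empirical frequency of `B` above `π B`. -/
lemma IsMarkovChain.measureReal_le_sum_indicator (hZ : IsMarkovChain μ Z ν κ) {t : ℕ}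
    (ht : 1 ≤ t) (hκ : HalvesOscillation (κ ^ t)) {B : Set E} (hB : MeasurableSet B) {n : ℕ}
    (hn : 1 ≤ n) {u : ℝ} (hu : 0 ≤ u) {a : ℝ}
    (ha : n * (π.real B + u + meanBias κ ν π n) ≤ a) :
    μ.real {ω | a ≤ ∑ i ∈ Finset.range n, B.indicator (1 : E → ℝ) (Z (i + 1) ω)} ≤
      Real.exp (-(n * u ^ 2 / (2 * t))) := by
  refine le_trans (measureReal_mono fun ω (hω : a ≤ _) => ?_)
    (hZ.measureReal_sum_ge_le ht hκ (g := B.indicator 1) (measurable_one.indicator hB) ?_ hn hu)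
  · have hint : ∀ k, ∫ ω, B.indicator (1 : E → ℝ) (Z k ω) ∂μ = μ.real (Z k ⁻¹' B) := fun k =>
      integral_indicator_one (hZ.measurable k hB)
    have := (abs_le.1 (hZ.abs_sum_measureReal_sub_le (π := π) hn hB)).2
    simp only [Set.mem_ofPred_eq, hint, Finset.sum_sub_distrib]
    linarith
  · intro x y
    by_cases hx : x ∈ B <;> by_cases hy : y ∈ B <;> simp [hx, hy]

/-- Lower deviations of the empirical frequency of `B` below `π B`. -/
lemma IsMarkovChain.measureReal_sum_indicator_le (hZ : IsMarkovChain μ Z ν κ) {t : ℕ}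
    (ht : 1 ≤ t) (hκ : HalvesOscillation (κ ^ t)) {B : Set E} (hB : MeasurableSet B) {n : ℕ}
    (hn : 1 ≤ n) {u : ℝ} (hu : 0 ≤ u) {a : ℝ}
    (ha : a ≤ n * (π.real B - u - meanBias κ ν π n)) :
    μ.real {ω | ∑ i ∈ Finset.range n, B.indicator (1 : E → ℝ) (Z (i + 1) ω) ≤ a} ≤
      Real.exp (-(n * u ^ 2 / (2 * t))) := by
  refine le_trans (measureReal_mono fun ω (hω : _ ≤ a) => ?_)
    (hZ.measureReal_sum_ge_le ht hκ (g := fun x => -B.indicator 1 x)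
      (measurable_one.indicator hB).neg ?_ hn hu)
  · have hint : ∀ k, ∫ ω, B.indicator (1 : E → ℝ) (Z k ω) ∂μ = μ.real (Z k ⁻¹' B) := fun k =>
      integral_indicator_one (hZ.measurable k hB)
    have := (abs_le.1 (hZ.abs_sum_measureReal_sub_le (π := π) hn hB)).1
    simp only [Set.mem_ofPred_eq, integral_neg, hint,
      Finset.sum_sub_distrib, Finset.sum_neg_distrib]
    linarith
  · intro x y
    by_cases hx : x ∈ B <;> by_cases hy : y ∈ B <;> simp [hx, hy]

lemma card_filter_eq_sum_indicator {E : Type*} {n : ℕ} (x : ℕ → E) (B : Set E) (P : Fin n → Prop)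
    [DecidablePred P] (hP : ∀ i : Fin n, P i ↔ x (i + 1) ∈ B) :
    ((Finset.univ.filter P).card : ℝ) =
      ∑ i ∈ Finset.range n, B.indicator (1 : E → ℝ) (x (i + 1)) := by
  classical
  rw [Finset.card_filter, Finset.sum_range]
  push_cast
  refine Finset.sum_congr rfl fun i _ => ?_
  simp [Set.indicator_apply, hP i]

/-- The conformal coverage event for a score function `h` fixed in advance. -/
def fixedCoverage (h : E → ℝ) (Z : ℕ → Ω → E) (n : ℕ) (α : ℝ) : Set Ω :=
  {ω | ((h (Z (n + 1) ω) : ℝ) : EReal) ≤ conformalQuantile α fun i : Fin n => h (Z (i + 1) ω)}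

/-- Coverage is at least the `π`-mass below a deterministic quantile `q` of level slightly less
than `1 - α`, unless the conformal quantile falls below `q`; no independence between the test and
calibration points is used. -/
lemma IsMarkovChain.le_measureReal_fixedCoverage (hZ : IsMarkovChain μ Z ν κ) {t : ℕ}
    (ht : 1 ≤ t) (hκ : HalvesOscillation (κ ^ t)) {h : E → ℝ} (hh : Measurable h) {n : ℕ}
    (hn : 1 ≤ n) {α : ℝ} (hα : 0 < α) (hα1 : α < 1) {u : ℝ} (hu : 0 ≤ u) :
    1 - α - (u + Real.exp (-(n * u ^ 2 / (2 * t))) + meanBias κ ν π n +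
      tvToStationary κ ν π (n + 1)) ≤ μ.real (fixedCoverage h Z n α) := by
  have hb : 0 ≤ meanBias κ ν π n := mul_nonneg (by positivity)
    (Finset.sum_nonneg fun _ _ => tvToStationary_nonneg _ _ _ _)
  have hd := tvToStationary_nonneg κ ν π (n + 1)
  have he := Real.exp_pos (-(n * u ^ 2 / (2 * t)))
  set p := 1 - α - u - meanBias κ ν π n with hp
  rcases le_or_gt p 0 with hp0 | hp0
  · exact le_trans (by linarith) measureReal_nonneg
  obtain ⟨q, hq1, hq2⟩ := exists_quantile π hh hp0 (by linarith)
  have hB : MeasurableSet {x | h x < q} := measurableSet_lt hh measurable_const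
  have hB' : MeasurableSet {x | h x ≤ q} := measurableSet_le hh measurable_const
  have hdev := hZ.measureReal_le_sum_indicator (π := π) ht hκ hB hn hu
    (a := n * (1 - α)) (by gcongr; linarith)
  have htest := (abs_le.1 (hZ.abs_measureReal_preimage_sub_le (π := π) (n + 1) hB')).1
  have hsub : Z (n + 1) ⁻¹' {x | h x ≤ q} ⊆ fixedCoverage h Z n α ∪
      {ω | n * (1 - α) ≤ ∑ i ∈ Finset.range n,
        {x | h x < q}.indicator (1 : E → ℝ) (Z (i + 1) ω)} := by
    intro ω (hω : h (Z (n + 1) ω) ≤ q)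
    by_contra hnot
    simp only [Set.mem_union, not_or, fixedCoverage, Set.mem_ofPred_eq, le_conformalQuantile_iff,
      not_lt, not_le] at hnot
    obtain ⟨h1, h2⟩ := hnot
    have h3 : ⌈((n : ℝ) + 1) * (1 - α)⌉₊ ≤
        (Finset.univ.filter fun i : Fin n => h (Z (i + 1) ω) < q).card :=
      h1.trans (Finset.card_le_card fun i hi => by
        simp only [Finset.mem_filter, Finset.mem_univ, true_and] at hi ⊢
        exact hi.trans_le hω)
    have h4 := (Nat.le_ceil (((n : ℝ) + 1) * (1 - α))).trans (Nat.cast_le.2 h3)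
    rw [card_filter_eq_sum_indicator (fun i => Z i ω) {x | h x < q}
      (fun i : Fin n => h (Z (i + 1) ω) < q) fun i => Iff.rfl] at h4
    linarith
  have := (measureReal_mono (μ := μ) hsub).trans (measureReal_union_le _ _)
  linarith

/-- Coverage is at most the `π`-mass below a deterministic quantile `q` of level slightly more than
`1 - α`, unless the conformal quantile exceeds `q`. Without atoms that mass equals the level. -/
lemma IsMarkovChain.measureReal_fixedCoverage_le (hZ : IsMarkovChain μ Z ν κ) {t : ℕ}
    (ht : 1 ≤ t) (hκ : HalvesOscillation (κ ^ t)) {h : E → ℝ} (hh : Measurable h)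
    (hatom : ∀ c : ℝ, π {z | h z = c} = 0) {n : ℕ}
    (hn : 1 ≤ n) {α : ℝ} (hα1 : α < 1) {u : ℝ} (hu : 0 ≤ u) :
    μ.real (fixedCoverage h Z n α) ≤ 1 - α + (u + Real.exp (-(n * u ^ 2 / (2 * t))) +
      meanBias κ ν π n + tvToStationary κ ν π (n + 1)) + (1 - α) / n := by
  have hb : 0 ≤ meanBias κ ν π n := mul_nonneg (by positivity)
    (Finset.sum_nonneg fun _ _ => tvToStationary_nonneg _ _ _ _)
  have hd := tvToStationary_nonneg κ ν π (n + 1)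
  have he := Real.exp_pos (-(n * u ^ 2 / (2 * t)))
  have hn' : (0 : ℝ) < n := by positivity
  have hαn : 0 < (1 - α) / n := div_pos (by linarith) hn'
  -- the term `(1 - α) / n` accounts for the threshold `(n + 1) (1 - α)` instead of `n (1 - α)`
  set p := 1 - α + u + meanBias κ ν π n + (1 - α) / n with hp
  rcases le_or_gt 1 p with hp1 | hp1
  · exact le_trans measureReal_le_one (by linarith)
  obtain ⟨q, hq1, hq2⟩ := exists_quantile π hh (by linarith : 0 < p) hp1
  have hB' : MeasurableSet {x | h x ≤ q} := measurableSet_le hh measurable_const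
  have hq : π.real {x | h x ≤ q} = p := by
    refine le_antisymm ?_ hq2
    have hun : {x | h x ≤ q} ⊆ {x | h x < q} ∪ {x | h x = q} := fun x (hx : h x ≤ q) =>
      hx.lt_or_eq
    have h0 : π.real {x | h x = q} = 0 := by simp [measureReal_def, hatom q]
    have := (measureReal_mono (μ := π) hun).trans (measureReal_union_le _ _)
    linarith
  have hdev := hZ.measureReal_sum_indicator_le (π := π) ht hκ hB' hn hu
    (a := ((n : ℝ) + 1) * (1 - α)) (by
      rw [hq, hp]
      apply le_of_eq
      field_simp
      ring)
  have htest := (abs_le.1 (hZ.abs_measureReal_preimage_sub_le (π := π) (n + 1) hB')).2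
  have hsub : fixedCoverage h Z n α ⊆ Z (n + 1) ⁻¹' {x | h x ≤ q} ∪
      {ω | ∑ i ∈ Finset.range n, {x | h x ≤ q}.indicator (1 : E → ℝ) (Z (i + 1) ω) ≤
        ((n : ℝ) + 1) * (1 - α)} := by
    intro ω hω
    by_contra hnot
    simp only [Set.mem_union, not_or, Set.mem_ofPred_eq, Set.mem_preimage, not_le] at hnot
    obtain ⟨h1, h2⟩ := hnot
    rw [fixedCoverage, Set.mem_ofPred_eq, le_conformalQuantile_iff] at hω
    have h3 : (Finset.univ.filter fun i : Fin n => h (Z (i + 1) ω) ≤ q).card <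
        ⌈((n : ℝ) + 1) * (1 - α)⌉₊ := lt_of_le_of_lt (Finset.card_le_card fun i hi => by
      simp only [Finset.mem_filter, Finset.mem_univ, true_and] at hi ⊢
      exact hi.trans_lt h1) hω
    have h4 := Nat.lt_ceil.1 h3
    rw [card_filter_eq_sum_indicator (fun i => Z i ω) {x | h x ≤ q}
      (fun i : Fin n => h (Z (i + 1) ω) ≤ q) fun i => Iff.rfl] at h4
    linarith
  have := (measureReal_mono (μ := μ) hsub).trans (measureReal_union_le _ _)
  linarith

end Coverage

/-! ### The Lambert function and the leading term -/

/-- The supremum defining `lambertWm1 (-y)` is attained. -/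
lemma exists_lambertWm1_eq_neg {y : ℝ} (hy : 0 < y) (hy1 : y ≤ Real.exp (-1)) :
    ∃ w : ℝ, 1 ≤ w ∧ lambertWm1 (-y) = -w ∧ w * Real.exp (-w) = y := by
  let S : Set ℝ := {z : ℝ | z ≤ -1 ∧ z * Real.exp z = -y}
  have hne : S.Nonempty := by
    have htend := Real.tendsto_pow_mul_exp_neg_atTop_nhds_zero 1
    obtain ⟨b, hb, hb1⟩ := ((htend.eventually (eventually_le_nhds hy)).and
      (Filter.eventually_ge_atTop 1)).exists
    have hcont : ContinuousOn (fun w : ℝ => w * Real.exp (-w)) (Set.Icc 1 b) := by fun_prop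
    obtain ⟨w, hw, hwy⟩ := intermediate_value_Icc' hb1 hcont
      (show y ∈ Set.Icc _ _ from ⟨by simpa using hb, by simpa using hy1⟩)
    exact ⟨-w, by linarith [hw.1], by simp only at hwy; linarith⟩
  have hcl : IsClosed S :=
    (isClosed_le continuous_id continuous_const).inter
      (isClosed_eq (by fun_prop : Continuous fun z : ℝ => z * Real.exp z) continuous_const)
  obtain ⟨h1, h2⟩ := hcl.csSup_mem hne ⟨-1, fun z hz => hz.1⟩
  refine ⟨-sSup S, by linarith, by rw [neg_neg]; rfl, by rw [neg_neg]; linarith⟩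

lemma nZero_pos {t : ℕ} (ht : 1 ≤ t) : 0 < nZero t := by
  have : (1 : ℝ) ≤ t := by exact_mod_cast ht
  unfold nZero; linarith

lemma pos_of_exp_mul_nZero_le {t : ℕ} (ht : 1 ≤ t) {x : ℝ} (hx : Real.exp 1 * nZero t ≤ x) :
    0 < x := (mul_pos (Real.exp_pos 1) (nZero_pos ht)).trans_le hx

/-- With `y = n₀ / x` and `w = -W₋₁(-y)`, the leading term is `√(w y) + exp (-w / 2)`. -/
lemma exists_lambertGap_eq {t : ℕ} (ht : 1 ≤ t) {x : ℝ} (hx : Real.exp 1 * nZero t ≤ x) :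
    ∃ w : ℝ, 1 ≤ w ∧ w * Real.exp (-w) = nZero t / x ∧
      lambertGap t x = Real.sqrt (w * (nZero t / x)) + Real.exp (-(w / 2)) := by
  have hx0 := pos_of_exp_mul_nZero_le ht hx
  obtain ⟨w, hw, hW, hwy⟩ := exists_lambertWm1_eq_neg (div_pos (nZero_pos ht) hx0) (by
    rw [div_le_iff₀ hx0, Real.exp_neg, ← div_eq_inv_mul, le_div_iff₀ (Real.exp_pos 1)]
    linarith)
  refine ⟨w, hw, hwy, ?_⟩
  rw [lambertGap, hW, neg_neg]
  ring_nf

lemma sqrt_mul_mul_exp_neg {w y : ℝ} (hw : 0 ≤ w) (hwy : w * Real.exp (-w) = y) :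
    Real.sqrt (w * y) = w * Real.exp (-(w / 2)) := by
  have : w * y = (w * Real.exp (-(w / 2))) ^ 2 := by
    rw [mul_pow, ← Real.exp_nat_mul, ← hwy]; push_cast; ring_nf
  rw [this, Real.sqrt_sq (by positivity)]

/-- The leading term is trivial, that is at least `1`, when `exp w < 9`. -/
lemma one_le_of_exp_lt_nine {w : ℝ} (hw : 0 ≤ w) (h9 : Real.exp w < 9) :
    1 ≤ w * Real.exp (-(w / 2)) + Real.exp (-(w / 2)) := by
  suffices h : Real.exp (w / 2) ≤ w + 1 by
    have : Real.exp (w / 2) * Real.exp (-(w / 2)) ≤ (w + 1) * Real.exp (-(w / 2)) := by gcongr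
    rw [← Real.exp_add, add_neg_cancel, Real.exp_zero] at this
    linarith
  rcases le_or_gt 2 w with h2 | h2
  · have : Real.exp (w / 2) ^ 2 < 3 ^ 2 := by
      rw [← Real.exp_nat_mul]; push_cast; rw [mul_div_cancel₀ _ two_ne_zero]; linarith
    have := lt_of_pow_lt_pow_left₀ 2 (by norm_num) this
    linarith
  · -- on `[0, 2]` the convex function `exp (w / 2)` lies below its chord
    have hc := convexOn_exp.2 (Set.mem_univ 0) (Set.mem_univ 1)
      (by linarith : 0 ≤ 1 - w / 2) (by linarith : 0 ≤ w / 2) (by ring)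
    simp only [smul_eq_mul, mul_zero, mul_one, zero_add, Real.exp_zero] at hc
    have he := Real.exp_one_lt_d9
    nlinarith

/-- The leading term is of order `√(t log x / x)`. -/
lemma lambertGap_le {t : ℕ} (ht : 1 ≤ t) {x : ℝ} (hx : Real.exp 1 * nZero t ≤ x) :
    lambertGap t x ≤
      Real.sqrt (2 * Real.log x * (nZero t / x)) + Real.sqrt (nZero t / x) := by
  obtain ⟨w, hw, hwy, hgap⟩ := exists_lambertGap_eq ht hx
  have hx0 := pos_of_exp_mul_nZero_le ht hx
  have hn0 := nZero_pos ht
  have hn1 : 1 ≤ nZero t := by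
    have : (1 : ℝ) ≤ t := by exact_mod_cast ht
    unfold nZero; linarith
  set y := nZero t / x with hy
  have hy0 : 0 < y := div_pos hn0 hx0
  rw [hgap]
  have hw2 : w ≤ Real.exp (w / 2) := by
    have h1 := Real.add_one_le_exp (w / 2 - 1)
    have h2 : Real.exp (w / 2) = Real.exp 1 * Real.exp (w / 2 - 1) := by
      rw [← Real.exp_add]; ring_nf
    have h3 := Real.add_one_le_exp (1 : ℝ)
    rw [h2]
    nlinarith [Real.exp_pos (w / 2 - 1)]
  have hwlog : w ≤ 2 * Real.log x := by
    have h1 : y * Real.exp (w / 2) ≤ 1 := by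
      rw [← hwy]
      calc w * Real.exp (-w) * Real.exp (w / 2)
          ≤ Real.exp (w / 2) * Real.exp (-w) * Real.exp (w / 2) := by gcongr
        _ = 1 := by rw [← Real.exp_add, ← Real.exp_add]; ring_nf; simp
    have h2 : Real.exp (w / 2) ≤ x := by
      have : y * x = nZero t := div_mul_cancel₀ _ hx0.ne'
      have : y * Real.exp (w / 2) ≤ y * x := by linarith
      exact le_of_mul_le_mul_left this hy0
    have := (Real.le_log_iff_exp_le hx0).2 h2
    linarith
  have hexp : Real.exp (-(w / 2)) ≤ Real.sqrt y := by
    refine Real.le_sqrt_of_sq_le ?_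
    rw [← Real.exp_nat_mul, ← hwy]
    have : ((2 : ℕ) : ℝ) * -(w / 2) = -w := by push_cast; ring
    rw [this]
    exact le_mul_of_one_le_left (Real.exp_pos _).le hw
  gcongr

/-! ### Sums of the mixing bound -/

lemma sum_range_half_pow_div_le {t : ℕ} (ht : 1 ≤ t) (n : ℕ) :
    ∑ i ∈ Finset.range n, (1 / 2 : ℝ) ^ (i / t) ≤ 2 * t := by
  have hblock : ∀ M : ℕ, ∑ i ∈ Finset.range (M * t), (1 / 2 : ℝ) ^ (i / t) =
      2 * t * (1 - (1 / 2) ^ M) := by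
    intro M
    induction M with
    | zero => simp
    | succ M ih =>
      rw [Nat.succ_mul, Finset.sum_range_add, ih]
      have : ∀ i ∈ Finset.range t, (1 / 2 : ℝ) ^ ((M * t + i) / t) = (1 / 2) ^ M := by
        intro i hi
        rw [Nat.add_comm, Nat.add_mul_div_right _ _ (by omega),
          Nat.div_eq_of_lt (Finset.mem_range.1 hi), zero_add]
      rw [Finset.sum_congr rfl this]
      simp only [Finset.sum_const, Finset.card_range, nsmul_eq_mul, pow_succ]
      ring
  have hsub : Finset.range n ⊆ Finset.range (n * t) :=
    Finset.range_subset_range.2 (Nat.le_mul_of_pos_right n (by omega))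
  refine (Finset.sum_le_sum_of_subset_of_nonneg hsub fun _ _ _ => by positivity).trans ?_
  rw [hblock]
  have : (0 : ℝ) ≤ (1 / 2) ^ n := by positivity
  have : (0 : ℝ) ≤ t := by positivity
  nlinarith

lemma four_mul_succ_le_two_pow {m : ℕ} (hm : 5 ≤ m) : 4 * (m + 1) ≤ 2 ^ m := by
  induction m, hm using Nat.le_induction with
  | base => norm_num
  | succ m hm ih => rw [pow_succ]; omega

/-- For `n ≥ 6 t` the distance to stationarity at time `n + 1` is a small fraction of `t / n`. -/
lemma half_pow_div_le {t n : ℕ} (ht : 1 ≤ t) (hn : 6 * t ≤ n) :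
    (1 / 2 : ℝ) ^ ((n + 1) / t) ≤ t / (4 * n) := by
  set m := (n + 1) / t with hm
  have hm5 : 5 ≤ m := (Nat.le_div_iff_mul_le (by omega)).2 (by omega)
  have hlt : n + 1 < (m + 1) * t := Nat.lt_mul_of_div_lt (Nat.lt_succ_self _) (by omega)
  have h2 : ((4 * (m + 1) : ℕ) : ℝ) ≤ ((2 ^ m : ℕ) : ℝ) :=
    Nat.cast_le.2 (four_mul_succ_le_two_pow hm5)
  have h3 : ((n + 1 : ℕ) : ℝ) < (((m + 1) * t : ℕ) : ℝ) := Nat.cast_lt.2 hlt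
  have hn0 : (0 : ℝ) < n := by
    have : 0 < n := by omega
    exact_mod_cast this
  have ht0 : (0 : ℝ) < t := by exact_mod_cast ht
  push_cast at h2 h3
  rw [one_div, inv_pow, ← one_div, div_le_div_iff₀ (by positivity) (by positivity)]
  nlinarith

/-! ### Coverage for a fitted score function -/

lemma le_measureReal_of_eq_lintegral {Ω : Type*} [MeasurableSpace Ω] {μ : Measure Ω}
    [IsProbabilityMeasure μ] {A : Set Ω} {m : Ω → ℝ≥0∞} {c : ℝ} (hA : μ A = ∫⁻ ω, m ω ∂μ)
    (hc : ∀ ω, ENNReal.ofReal c ≤ m ω) : c ≤ μ.real A := by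
  have : ENNReal.ofReal c ≤ μ A := by
    rw [hA]
    calc ENNReal.ofReal c = ∫⁻ _, ENNReal.ofReal c ∂μ := by simp
      _ ≤ _ := lintegral_mono hc
  rwa [measureReal_def, ← ENNReal.ofReal_le_iff_le_toReal (measure_ne_top _ _)]

lemma measureReal_le_of_eq_lintegral {Ω : Type*} [MeasurableSpace Ω] {μ : Measure Ω}
    [IsProbabilityMeasure μ] {A : Set Ω} {m : Ω → ℝ≥0∞} {c : ℝ} (hA : μ A = ∫⁻ ω, m ω ∂μ)
    (hc0 : 0 ≤ c) (hc : ∀ᵐ ω ∂μ, m ω ≤ ENNReal.ofReal c) : μ.real A ≤ c := by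
  refine ENNReal.toReal_le_of_le_ofReal hc0 ?_
  rw [hA]
  calc _ ≤ ∫⁻ _, ENNReal.ofReal c ∂μ := lintegral_mono_ae hc
    _ = ENNReal.ofReal c := by simp

section Gap

variable {Ω E : Type*} [MeasurableSpace Ω] [MeasurableSpace E]
  {μ : Measure Ω} [IsProbabilityMeasure μ] {κ : Kernel E E} [IsMarkovKernel κ]
  {Z : ℕ → Ω → E} {ν π : Measure E} [IsProbabilityMeasure π]

/-- At `u = √(w y)`, the deviation probability is at most `exp (-w / 2)`. -/
lemma exp_deviation_le {t : ℕ} (ht : 1 ≤ t) {x : ℝ} (hx : 0 < x) {w : ℝ} (hw : 0 ≤ w) :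
    Real.exp (-(x * Real.sqrt (w * (nZero t / x)) ^ 2 / (2 * t))) ≤ Real.exp (-(w / 2)) := by
  have ht0 : (0 : ℝ) < t := by exact_mod_cast ht
  have hn0 := nZero_pos ht
  rw [Real.sq_sqrt (by positivity)]
  have : x * (w * (nZero t / x)) / (2 * t) = 9 / 8 * w := by
    unfold nZero; field_simp; ring
  rw [this]
  gcongr
  linarith

lemma one_le_of_exp_mul_nZero_le {tmix n : ℕ} (ht : 1 ≤ tmix)
    (hn : Real.exp 1 * nZero tmix ≤ n) : 1 ≤ n := by
  have := pos_of_exp_mul_nZero_le ht hn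
  exact_mod_cast this

lemma IsMarkovChain.coverage_restart (hZ : IsMarkovChain μ Z ν κ) {t : ℕ}
    (ht : 1 ≤ t) (hκ : HalvesOscillation (κ ^ t)) {h : E → ℝ} (hh : Measurable h) {n : ℕ}
    {α : ℝ} (hα : 0 < α) (hα1 : α < 1) (hn : Real.exp 1 * nZero t ≤ n) :
    1 - α - gapRestart t (tvToStationary κ ν π) n ≤ μ.real (fixedCoverage h Z n α) ∧
      ((∀ c : ℝ, π {z | h z = c} = 0) → μ.real (fixedCoverage h Z n α) ≤
        1 - α + gapRestart t (tvToStationary κ ν π) n + (1 - α) / n) := by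
  obtain ⟨w, hw, -, hgap⟩ := exists_lambertGap_eq ht hn
  have hn0 := pos_of_exp_mul_nZero_le ht hn
  have hn1 := one_le_of_exp_mul_nZero_le ht hn
  have hdev := exp_deviation_le ht hn0 (zero_le_one.trans hw)
  have hrestart : gapRestart t (tvToStationary κ ν π) n =
      lambertGap t n + meanBias κ ν π n + tvToStationary κ ν π (n + 1) := rfl
  rw [hrestart, hgap]
  refine ⟨?_, fun hatom => ?_⟩
  · have := hZ.le_measureReal_fixedCoverage (π := π) ht hκ hh hn1 hα hα1
      (Real.sqrt_nonneg (w * (nZero t / n)))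
    linarith
  · have := hZ.measureReal_fixedCoverage_le ht hκ hh hatom hn1 hα1
      (Real.sqrt_nonneg (w * (nZero t / n)))
    linarith

/-- The bias from an arbitrary initial law: `n₀ / n = 2 t / n + t / (4 n)`, where the two terms
bound the contributions of the calibration points and of the test point. -/
lemma meanBias_add_le [IsProbabilityMeasure ν] (hπ : Kernel.Invariant κ π) {t n : ℕ}
    (ht : 1 ≤ t) (hκ : HalvesOscillation (κ ^ t)) (hn : 6 * t ≤ n) :
    meanBias κ ν π n + tvToStationary κ ν π (n + 1) ≤ nZero t / n := by
  have hn0 : (0 : ℝ) < n := by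
    have : 0 < n := by omega
    exact_mod_cast this
  have h1 : ∑ i ∈ Finset.Icc 1 n, tvToStationary κ ν π i ≤ 2 * t :=
    calc _ ≤ ∑ i ∈ Finset.Icc 1 n, (1 / 2 : ℝ) ^ (i / t) :=
          Finset.sum_le_sum fun i _ => tvToStationary_le hπ ht hκ i
      _ ≤ ∑ i ∈ Finset.range (n + 1), (1 / 2 : ℝ) ^ (i / t) :=
          Finset.sum_le_sum_of_subset_of_nonneg (fun i hi => by
            simp only [Finset.mem_Icc, Finset.mem_range] at hi ⊢; omega)
            fun _ _ _ => by positivity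
      _ ≤ _ := sum_range_half_pow_div_le ht _
  have h2 := (tvToStationary_le (ν := ν) hπ ht hκ (n + 1)).trans (half_pow_div_le ht hn)
  have h3 : nZero t / n = 1 / n * (2 * t) + t / (4 * n) := by
    unfold nZero; field_simp; norm_num
  rw [h3, meanBias]
  gcongr

/-- From any initial law, coverage holds with the leading term alone, even for an effective sample
size `x ≤ n`: the concentration inequality is sharper than needed by the factor `9 / 4` in the
exponent, which pays for the bias, at most `n₀ / n`, of the initial law. -/
lemma IsMarkovChain.coverage_of_any_start (hZ : IsMarkovChain μ Z ν κ)
    (hπ : Kernel.Invariant κ π) {t : ℕ}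
    (ht : 1 ≤ t) (hκ : HalvesOscillation (κ ^ t)) {h : E → ℝ} (hh : Measurable h) {n : ℕ}
    {α : ℝ} (hα : 0 < α) (hα1 : α < 1) {x : ℝ} (hx : Real.exp 1 * nZero t ≤ x) (hxn : x ≤ n) :
    1 - α - lambertGap t x ≤ μ.real (fixedCoverage h Z n α) ∧
      ((∀ c : ℝ, π {z | h z = c} = 0) → μ.real (fixedCoverage h Z n α) ≤
        1 - α + lambertGap t x + (1 - α) / n) := by
  have := hZ.isProbabilityMeasure
  obtain ⟨w, hw, hwy, hgap⟩ := exists_lambertGap_eq ht hx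
  have hx0 := pos_of_exp_mul_nZero_le ht hx
  have hn1 := one_le_of_exp_mul_nZero_le ht (hx.trans hxn)
  have ht0 : (0 : ℝ) < t := by exact_mod_cast ht
  have hn0 : (0 : ℝ) < n := hx0.trans_le hxn
  have hw0 : 0 ≤ w := zero_le_one.trans hw
  have hn₀ := nZero_pos ht
  rcases lt_or_ge (Real.exp w) 9 with h9 | h9
  · have h1 := one_le_of_exp_lt_nine hw0 h9
    rw [← sqrt_mul_mul_exp_neg hw0 hwy, ← hgap] at h1
    refine ⟨le_trans (by linarith) measureReal_nonneg, fun _ => le_trans measureReal_le_one ?_⟩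
    have : 0 ≤ (1 - α) / n := div_nonneg (by linarith) hn0.le
    linarith
  · set y := nZero t / x with hy
    have hy0 : 0 < y := div_pos hn₀ hx0
    set u := Real.sqrt (w * y) with hu
    -- `exp w ≥ 9` means `3 y ≤ u`, so that lowering `u` by `y` loses at most a third of it
    have hu3 : 3 * y ≤ u := by
      refine Real.le_sqrt_of_sq_le ?_
      have : 9 * y ≤ w := by
        rw [← hwy]
        calc 9 * (w * Real.exp (-w)) ≤ Real.exp w * (w * Real.exp (-w)) := by gcongr
          _ = w * (Real.exp w * Real.exp (-w)) := by ring
          _ = w := by rw [← Real.exp_add, add_neg_cancel, Real.exp_zero, mul_one]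
      nlinarith
    have hny : nZero t ≤ n * y := by
      have : x * y = nZero t := mul_div_cancel₀ _ hx0.ne'
      nlinarith
    have hbias : meanBias κ ν π n + tvToStationary κ ν π (n + 1) ≤ y := by
      refine (meanBias_add_le hπ ht hκ ?_).trans ((div_le_iff₀ hn0).2 (by linarith))
      have he := Real.exp_one_gt_d9
      have : (6 * t : ℝ) ≤ n := by
        unfold nZero at hx
        nlinarith
      exact_mod_cast this
    have hdev : Real.exp (-(n * (u - y) ^ 2 / (2 * t))) ≤ Real.exp (-(w / 2)) := by
      have h1 : 4 / 9 * (w * y) ≤ (u - y) ^ 2 := by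
        have : w * y = u ^ 2 := (Real.sq_sqrt (by positivity)).symm
        rw [this]
        nlinarith
      have h2 : w / 2 ≤ n * (u - y) ^ 2 / (2 * t) := by
        rw [le_div_iff₀ (by positivity)]
        have h3 : n * (4 / 9 * (w * y)) ≤ n * (u - y) ^ 2 := by gcongr
        have h4 : w * nZero t ≤ w * (n * y) := by gcongr
        unfold nZero at h4
        linarith
      gcongr
    rw [hgap]
    refine ⟨?_, fun hatom => ?_⟩
    · have := hZ.le_measureReal_fixedCoverage (π := π) ht hκ hh hn1 hα hα1
        (by linarith : 0 ≤ u - y)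
      linarith
    · have := hZ.measureReal_fixedCoverage_le ht hκ hh hatom hn1 hα1
        (by linarith : 0 ≤ u - y)
      linarith

lemma lambertGap_nonneg (t : ℕ) (x : ℝ) : 0 ≤ lambertGap t x :=
  add_nonneg (Real.sqrt_nonneg _) (Real.exp_pos _).le

/-- The coverage event of a score function fitted on a training set, as a measurable set of pairs
of an observation `p` determining the training set and a path `f`. -/
lemma measurableSet_coverage {H : Type*} [MeasurableSpace H] {N : ℕ}
    {s : (Fin N → E) → E → ℝ} (hs : Measurable (Function.uncurry s)) {D : H → Fin N → E}
    (hD : Measurable D) (n : ℕ) (α : ℝ) :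
    MeasurableSet {p : H × (ℕ → E) | p.2 ∈ fixedCoverage (s (D p.1)) (fun k f => f k) n α} := by
  have hm : ∀ k, Measurable fun p : H × (ℕ → E) => s (D p.1) (p.2 k) := fun k =>
    hs.comp ((hD.comp measurable_fst).prodMk ((measurable_pi_apply k).comp measurable_snd))
  exact measurableSet_le_conformalQuantile α (fun i => hm (i + 1)) (hm (n + 1))

variable {Z' : ℕ → Ω → E} {ν₀ ν₁ : Measure E}

/-- With an independent calibration chain, coverage is an average over the training set of the
coverages of fixed score functions. -/
lemma measure_coverageEvent_restart (hZ : ∀ k, Measurable (Z k)) (hZ' : ∀ k, Measurable (Z' k))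
    (hind : IndepFun (fun ω k => Z k ω) (fun ω k => Z' k ω) μ) {N : ℕ}
    {s : (Fin N → E) → E → ℝ} (hs : Measurable (Function.uncurry s)) (n : ℕ) (α : ℝ) :
    μ (coverageEvent s (trainingSet Z N) Z' 0 n α) =
      ∫⁻ ω, μ (fixedCoverage (s (trainingSet Z N ω)) Z' n α) ∂μ := by
  have hm : Measurable fun ω k => Z k ω := measurable_pi_lambda _ hZ
  have hm' : Measurable fun ω k => Z' k ω := measurable_pi_lambda _ hZ'
  have hD : Measurable fun f : ℕ → E => fun i : Fin N => f (i + 1) := by fun_prop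
  have hC := measurableSet_coverage hs hD n α
  set C := {p : (ℕ → E) × (ℕ → E) |
    p.2 ∈ fixedCoverage (s fun i : Fin N => p.1 (i + 1)) (fun k f => f k) n α} with hCdef
  have h1 : coverageEvent s (trainingSet Z N) Z' 0 n α =
      (fun ω => ((fun k => Z k ω), fun k => Z' k ω)) ⁻¹' C := by
    ext ω
    simp only [coverageEvent, zero_add, add_comm 1]
    rfl
  rw [h1, ← Measure.map_apply (hm.prodMk hm') hC,
    (indepFun_iff_map_prod_eq_prod_map_map hm.aemeasurable hm'.aemeasurable).1 hind]
  have := Measure.isProbabilityMeasure_map (μ := μ) hm'.aemeasurable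
  rw [Measure.prod_apply hC, lintegral_map (measurable_measure_prodMk_left hC) hm]
  refine lintegral_congr fun ω => ?_
  rw [Measure.map_apply hm' (hC.preimage (by fun_prop))]
  rfl

/-- On a single trajectory, coverage is an average, over the past up to the last training point, of
the coverages of fixed score functions for the chain started from that point. -/
lemma IsMarkovChain.measure_coverageEvent (hZ : IsMarkovChain μ Z ν κ) {N : ℕ}
    {s : (Fin N → E) → E → ℝ} (hs : Measurable (Function.uncurry s)) (n : ℕ) (α : ℝ) :
    μ (coverageEvent s (trainingSet Z N) Z N n α) =
      ∫⁻ ω, pathKernel κ (Z N ω)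
        (fixedCoverage (s (trainingSet Z N ω)) (fun k f => f k) n α) ∂μ := by
  let g : (Fin (N + 1) → E) → (Fin N → E) := fun p i => p ⟨i + 1, by omega⟩
  have hg : Measurable g := by fun_prop
  have hC := measurableSet_coverage hs measurable_id n α
  set C := {p : (Fin N → E) × (ℕ → E) |
    p.2 ∈ fixedCoverage (s (id p.1)) (fun k f => f k) n α} with hCdef
  have h1 : coverageEvent s (trainingSet Z N) Z N n α =
      (fun ω => (g fun i => Z i ω, fun j => Z (N + j) ω)) ⁻¹' C := by
    ext ω
    simp only [coverageEvent, add_assoc, add_comm 1]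
    rfl
  have hm : Measurable fun ω => (g fun i => Z i ω, fun j => Z (N + j) ω) :=
    (hg.comp (measurable_pi_lambda _ fun i => hZ.measurable i)).prodMk
      (measurable_pi_lambda _ fun j => hZ.measurable _)
  have hpath := hZ.lintegral_path N hg (measurable_one.indicator hC)
  rw [h1, ← lintegral_indicator_one (hm hC)]
  refine hpath.trans (lintegral_congr fun ω => ?_)
  exact lintegral_indicator_one (hC.preimage measurable_prodMk_left)

end Gap

lemma betaMixing_nonneg {Ω E : Type*} [MeasurableSpace Ω] [MeasurableSpace E]
    (μ : Measure Ω) (Z : ℕ → Ω → E) (a : ℕ) : 0 ≤ betaMixing μ Z a :=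
  Real.iSup_nonneg fun _ => tvDist_nonneg _ _

/-- All the terms of the coverage gap other than the leading one are nonnegative. -/
lemma lambertGap_le_gapNoRestart {Ω E : Type*} [MeasurableSpace Ω] [MeasurableSpace E]
    (μ : Measure Ω) (Z : ℕ → Ω → E) (κ : Kernel E E) (ν π : Measure E) (t : ℕ)
    {α : ℝ} (hα : 0 < α) (N n r : ℕ) :
    lambertGap t ((n : ℝ) - r) ≤
      gapNoRestart t (tvToStationary κ ν π) (betaMixing μ Z) α N n r := by
  have h1 : 0 ≤ (1 + r * α) / ((n : ℝ) + 1) := by positivity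
  have h2 := tvToStationary_nonneg κ ν π N
  have h3 := tvToStationary_nonneg κ ν π (n + N + 1)
  have h4 := betaMixing_nonneg μ Z (n + 1)
  have h5 := betaMixing_nonneg μ Z r
  unfold gapNoRestart
  linarith

section FittedCoverage

variable {Ω E : Type*} [MeasurableSpace Ω] [MeasurableSpace E]
  {μ : Measure Ω} [IsProbabilityMeasure μ] {κ : Kernel E E} [IsMarkovKernel κ]
  {Z Z' : ℕ → Ω → E} {ν ν₁ π : Measure E} [IsProbabilityMeasure π]

lemma coverageEvent_restart (hZ : IsMarkovChain μ Z ν κ) (hZ' : IsMarkovChain μ Z' ν₁ κ)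
    (hind : IndepFun (fun ω k => Z k ω) (fun ω k => Z' k ω) μ) {t : ℕ}
    (ht : 1 ≤ t) (hκ : HalvesOscillation (κ ^ t)) {N n : ℕ}
    {s : (Fin N → E) → E → ℝ} (hs : Measurable (Function.uncurry s)) {α : ℝ} (hα : 0 < α)
    (hα1 : α < 1) (hn : Real.exp 1 * nZero t ≤ n) :
    1 - α - gapRestart t (tvToStationary κ ν₁ π) n ≤
        μ.real (coverageEvent s (trainingSet Z N) Z' 0 n α) ∧
      ((∀ᵐ ω ∂μ, ∀ c : ℝ, π {z | s (trainingSet Z N ω) z = c} = 0) →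
        μ.real (coverageEvent s (trainingSet Z N) Z' 0 n α) ≤
          1 - α + gapRestart t (tvToStationary κ ν₁ π) n + (1 - α) / n) := by
  have hA := measure_coverageEvent_restart hZ.measurable hZ'.measurable hind hs n α
  have hsd : ∀ d, Measurable (s d) := fun d => hs.of_uncurry_left
  have key := fun d => hZ'.coverage_restart (π := π) ht hκ (hsd d) hα hα1 hn
  refine ⟨le_measureReal_of_eq_lintegral hA fun ω => ?_, fun hatom =>
    measureReal_le_of_eq_lintegral hA ?_ ?_⟩
  · exact (ENNReal.ofReal_le_iff_le_toReal (measure_ne_top _ _)).2 (key _).1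
  · have h1 : 0 ≤ gapRestart t (tvToStationary κ ν₁ π) n :=
      add_nonneg (add_nonneg (lambertGap_nonneg _ _) (mul_nonneg (by positivity)
        (Finset.sum_nonneg fun _ _ => tvToStationary_nonneg _ _ _ _)))
        (tvToStationary_nonneg _ _ _ _)
    have h2 : 0 ≤ (1 - α) / n := div_nonneg (by linarith) (by positivity)
    linarith
  · filter_upwards [hatom] with ω hω
    rw [← ENNReal.ofReal_toReal (measure_ne_top μ _)]
    exact ENNReal.ofReal_le_ofReal ((key _).2 hω)

lemma IsMarkovChain.coverageEvent_noRestart (hZ : IsMarkovChain μ Z ν κ)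
    (hπ : Kernel.Invariant κ π) {t : ℕ}
    (ht : 1 ≤ t) (hκ : HalvesOscillation (κ ^ t)) {N n r : ℕ}
    {s : (Fin N → E) → E → ℝ} (hs : Measurable (Function.uncurry s)) {α : ℝ} (hα : 0 < α)
    (hα1 : α < 1) (hn : Real.exp 1 * nZero t ≤ (n : ℝ) - r) :
    1 - α - gapNoRestart t (tvToStationary κ ν π) (betaMixing μ Z) α N n r ≤
        μ.real (coverageEvent s (trainingSet Z N) Z N n α) ∧
      ((∀ᵐ ω ∂μ, ∀ c : ℝ, π {z | s (trainingSet Z N ω) z = c} = 0) →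
        μ.real (coverageEvent s (trainingSet Z N) Z N n α) ≤
          1 - α + gapNoRestart t (tvToStationary κ ν π) (betaMixing μ Z) α N n r +
            (1 - α) / ((n : ℝ) - r)) := by
  have hA := hZ.measure_coverageEvent hs n α
  have hgap := lambertGap_le_gapNoRestart μ Z κ ν π t hα N n r
  have hx0 := pos_of_exp_mul_nZero_le ht hn
  have hrn : (n : ℝ) - r ≤ n := by
    have : (0 : ℝ) ≤ r := by positivity
    linarith
  have hsd : ∀ d, Measurable (s d) := fun d => hs.of_uncurry_left
  have key := fun x d => (isMarkovChain_pathKernel (κ := κ) x).coverage_of_any_start hπ ht hκ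
    (hsd d) hα hα1 hn hrn
  refine ⟨le_trans (by linarith) (le_measureReal_of_eq_lintegral
    (c := 1 - α - lambertGap t ((n : ℝ) - r)) hA fun ω => ?_), fun hatom =>
    le_trans (measureReal_le_of_eq_lintegral
      (c := 1 - α + lambertGap t ((n : ℝ) - r) + (1 - α) / n) hA ?_ ?_) ?_⟩
  · exact (ENNReal.ofReal_le_iff_le_toReal (measure_ne_top _ _)).2 (key _ _).1
  · have h1 := lambertGap_nonneg t ((n : ℝ) - r)
    have h2 : 0 ≤ (1 - α) / n := div_nonneg (by linarith) (by positivity)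
    linarith
  · filter_upwards [hatom] with ω hω
    rw [← ENNReal.ofReal_toReal (measure_ne_top (pathKernel κ (Z N ω)) _)]
    exact ENNReal.ofReal_le_ofReal ((key _ _).2 hω)
  · have : (1 - α) / n ≤ (1 - α) / ((n : ℝ) - r) :=
      div_le_div_of_nonneg_left (by linarith) hx0 hrn
    linarith

end FittedCoverage

/-! ### Decay of the β-mixing coefficients -/

section BetaMixing

variable {Ω E : Type*} [MeasurableSpace Ω] [MeasurableSpace E]
  {μ : Measure Ω} [IsProbabilityMeasure μ] {κ : Kernel E E} [IsMarkovKernel κ]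
  {Z : ℕ → Ω → E} {ν : Measure E}

/-- Forgetting of the starting point by the whole path from time `a` on. -/
lemma pathKernel_shift_sub_le {t : ℕ} (ht : 1 ≤ t) (hκ : HalvesOscillation (κ ^ t)) (a : ℕ)
    {B : Set (ℕ → E)} (hB : MeasurableSet B) (x y : E) :
    (pathKernel κ x).real {f | (fun j => f (a + j)) ∈ B} -
      (pathKernel κ y).real {f | (fun j => f (a + j)) ∈ B} ≤ (1 / 2) ^ (a / t) := by
  have hm : Measurable fun z => (pathKernel κ z).real B :=
    (Kernel.measurable_coe _ hB).ennreal_toReal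
  have hshift : Measurable fun (f : ℕ → E) j => f (a + j) := by fun_prop
  have key : ∀ z, (pathKernel κ z).real {f | (fun j => f (a + j)) ∈ B} =
      ∫ w, (pathKernel κ w).real B ∂((κ ^ a) z) := by
    intro z
    have h := (isMarkovChain_pathKernel (κ := κ) z).lintegral_path a
      (g := fun _ => ()) measurable_const (F := fun p => B.indicator 1 p.2)
      ((measurable_one.indicator hB).comp measurable_snd)
    simp only [lintegral_indicator_one hB] at h
    have h1 : ∫⁻ f, B.indicator 1 (fun j => f (a + j)) ∂(pathKernel κ z) =
        pathKernel κ z {f | (fun j => f (a + j)) ∈ B} :=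
      lintegral_indicator_one (hshift hB)
    rw [← pathKernel_map_eval, integral_map (measurable_pi_apply a).aemeasurable
      hm.aestronglyMeasurable, measureReal_def, ← h1, h,
      integral_eq_lintegral_of_nonneg_ae (ae_of_all _ fun _ => measureReal_nonneg)
        (hm.comp (measurable_pi_apply a)).aestronglyMeasurable]
    simp
  rw [key x, key y]
  have := integral_sub_integral_le (fun A hA => pow_measureReal_sub_le ht hκ a hA x y) hm
    (c := 1) fun z w => by
      have h1 : (pathKernel κ z).real B ≤ 1 := measureReal_le_one
      have h2 : 0 ≤ (pathKernel κ w).real B := measureReal_nonneg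
      linarith
  simpa using this

lemma IsMarkovChain.measure_past_future (hZ : IsMarkovChain μ Z ν κ) (k a : ℕ)
    {A : Set ((Fin k → E) × (ℕ → E))} (hA : MeasurableSet A) :
    μ ((fun ω => (fun i : Fin k => Z (i + 1) ω, fun j => Z (k + a + j) ω)) ⁻¹' A) =
      ∫⁻ ω, pathKernel κ (Z k ω)
        {f | (fun i : Fin k => Z (i + 1) ω, fun j => f (a + j)) ∈ A} ∂μ := by
  let g : (Fin (k + 1) → E) → (Fin k → E) := fun p i => p ⟨i + 1, by omega⟩
  have hg : Measurable g := by fun_prop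
  have hm : Measurable fun p : (Fin k → E) × (ℕ → E) => (p.1, fun j => p.2 (a + j)) := by fun_prop
  have hB := hm hA
  set B := (fun p : (Fin k → E) × (ℕ → E) => (p.1, fun j => p.2 (a + j))) ⁻¹' A with hBdef
  have h := hZ.lintegral_path k hg (measurable_one.indicator hB)
  have hmeas : Measurable fun ω => (g fun i => Z i ω, fun j => Z (k + j) ω) :=
    (hg.comp (measurable_pi_lambda _ fun i => hZ.measurable i)).prodMk
      (measurable_pi_lambda _ fun j => hZ.measurable _)
  have e : (fun ω => (fun i : Fin k => Z (i + 1) ω, fun j => Z (k + a + j) ω)) ⁻¹' A =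
      (fun ω => (g fun i => Z i ω, fun j => Z (k + j) ω)) ⁻¹' B := by
    simp only [add_assoc]
    rfl
  rw [e, ← lintegral_indicator_one (hmeas hB)]
  refine Eq.trans h (lintegral_congr fun ω => ?_)
  exact lintegral_indicator_one (hB.preimage measurable_prodMk_left)

lemma measurable_pathKernel_shift {H : Type*} [MeasurableSpace H] (a : ℕ)
    {A : Set (H × (ℕ → E))} (hA : MeasurableSet A) :
    Measurable fun p : E × H =>
      (pathKernel κ p.1).real {f | (p.2, fun j => f (a + j)) ∈ A} := by
  let Ψ : Kernel (E × H) (ℕ → E) := (pathKernel κ).comap Prod.fst measurable_fst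
  have hT : MeasurableSet {q : (E × H) × (ℕ → E) | (q.1.2, fun j => q.2 (a + j)) ∈ A} :=
    hA.preimage (by fun_prop)
  exact (Kernel.measurable_kernel_prodMk_left (κ := Ψ) hT).ennreal_toReal

/-- The past `(Z 1, …, Z k)` and the future from time `k + a` on are nearly independent, since the
future forgets the state at time `k`. -/
lemma IsMarkovChain.tvDist_past_future_le (hZ : IsMarkovChain μ Z ν κ) {t : ℕ} (ht : 1 ≤ t)
    (hκ : HalvesOscillation (κ ^ t)) (a k : ℕ) :
    tvDist ((μ.map fun ω => fun i : Fin k => Z (i + 1) ω).prod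
        (μ.map fun ω => fun j : ℕ => Z (k + a + j) ω))
      (μ.map fun ω => (fun i : Fin k => Z (i + 1) ω, fun j : ℕ => Z (k + a + j) ω)) ≤
      (1 / 2) ^ (a / t) := by
  refine tvDist_le fun A hA => ?_
  let X : Ω → Fin k → E := fun ω i => Z (i + 1) ω
  have hX : Measurable X := measurable_pi_lambda _ fun i => hZ.measurable _
  have hY : Measurable fun ω j => Z (k + a + j) ω := measurable_pi_lambda _ fun j => hZ.measurable _
  -- `Q x d` is the probability that the pair of `d` and the future from time `a` on lies in `A`
  obtain ⟨Q, hQ⟩ : ∃ Q : E → (Fin k → E) → ℝ, ∀ x d,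
      Q x d = (pathKernel κ x).real {f | (d, fun j => f (a + j)) ∈ A} := ⟨_, fun _ _ => rfl⟩
  have hQ1 : ∀ x d, Q x d ∈ Set.Icc (0 : ℝ) 1 := fun x d => by
    rw [hQ]; exact ⟨measureReal_nonneg, measureReal_le_one⟩
  have hQm : Measurable fun p : E × (Fin k → E) => Q p.1 p.2 := by
    simp only [hQ]; exact measurable_pathKernel_shift a hA
  have hQX : Measurable fun ω => Q (Z k ω) (X ω) := hQm.comp ((hZ.measurable k).prodMk hX)
  have hQd : ∀ d, Measurable fun ω => Q (Z k ω) d := fun d =>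
    hQm.comp ((hZ.measurable k).prodMk measurable_const)
  have hpath : ∀ A' : Set ((Fin k → E) × (ℕ → E)), MeasurableSet A' →
      μ ((fun ω => (X ω, fun j => Z (k + a + j) ω)) ⁻¹' A') =
        ∫⁻ ω, pathKernel κ (Z k ω) {f | (X ω, fun j => f (a + j)) ∈ A'} ∂μ :=
    fun A' hA' => hZ.measure_past_future k a hA'
  have hreal : ∀ {m : Ω → ℝ}, Measurable m → (∀ ω, 0 ≤ m ω) →
      ∫ ω, m ω ∂μ = (∫⁻ ω, ENNReal.ofReal (m ω) ∂μ).toReal := fun hm h0 =>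
    integral_eq_lintegral_of_nonneg_ae (ae_of_all _ h0) hm.aestronglyMeasurable
  have hjoint : (μ.map fun ω => (X ω, fun j => Z (k + a + j) ω)).real A =
      ∫ ω, Q (Z k ω) (X ω) ∂μ := by
    rw [map_measureReal_apply (hX.prodMk hY) hA, measureReal_def, hpath A hA,
      hreal hQX fun ω => (hQ1 _ _).1]
    simp [hQ]
  have hmarg : ∀ d, (μ.map fun ω j => Z (k + a + j) ω).real {f | (d, f) ∈ A} =
      ∫ ω, Q (Z k ω) d ∂μ := by
    intro d
    have hAd : MeasurableSet {f : ℕ → E | (d, f) ∈ A} := hA.preimage measurable_prodMk_left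
    have h := hpath (Set.univ ×ˢ {f | (d, f) ∈ A}) (MeasurableSet.univ.prod hAd)
    have e : (fun ω => (X ω, fun j => Z (k + a + j) ω)) ⁻¹' (Set.univ ×ˢ {f | (d, f) ∈ A}) =
        (fun ω j => Z (k + a + j) ω) ⁻¹' {f | (d, f) ∈ A} := by
      ext ω; simp
    rw [map_measureReal_apply hY hAd, measureReal_def, ← e, h,
      hreal (hQd d) fun ω => (hQ1 _ _).1]
    simp [hQ]
  have := Measure.isProbabilityMeasure_map (μ := μ) hX.aemeasurable
  have := Measure.isProbabilityMeasure_map (μ := μ) hY.aemeasurable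
  have hQi : ∀ d, Integrable (fun ω => Q (Z k ω) d) μ := fun d => Integrable.of_mem_Icc 0 1
    (hQd d).aemeasurable (ae_of_all _ fun _ => hQ1 _ _)
  have hPm : Measurable fun d => ∫ ω, Q (Z k ω) d ∂μ := by
    simp only [← hmarg]
    exact (measurable_measure_prodMk_left hA).ennreal_toReal
  have hPX : Measurable fun ω => ∫ ω', Q (Z k ω') (X ω) ∂μ := hPm.comp hX
  have hP1 : ∀ d, (∫ ω, Q (Z k ω) d ∂μ) ∈ Set.Icc (0 : ℝ) 1 := fun d => by
    rw [← hmarg]; exact ⟨measureReal_nonneg, measureReal_le_one⟩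
  have hprod : ((μ.map X).prod (μ.map fun ω j => Z (k + a + j) ω)).real A =
      ∫ ω, ∫ ω', Q (Z k ω') (X ω) ∂μ ∂μ := by
    rw [measureReal_def, Measure.prod_apply hA,
      lintegral_map (measurable_measure_prodMk_left hA) hX,
      hreal hPX fun ω => (hP1 _).1]
    congr 1
    refine lintegral_congr fun ω => ?_
    rw [← hmarg, ofReal_measureReal]
    rfl
  have hdiff : ∀ ω, |(∫ ω', Q (Z k ω') (X ω) ∂μ) - Q (Z k ω) (X ω)| ≤ (1 / 2) ^ (a / t) := by
    intro ω
    have h1 : ∀ x y, Q x (X ω) - Q y (X ω) ≤ (1 / 2) ^ (a / t) := fun x y => by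
      rw [hQ, hQ]
      exact pathKernel_shift_sub_le ht hκ a (hA.preimage measurable_prodMk_left) x y
    have h2 : (∫ ω', Q (Z k ω') (X ω) ∂μ) - Q (Z k ω) (X ω) =
        ∫ ω', (Q (Z k ω') (X ω) - Q (Z k ω) (X ω)) ∂μ := by
      rw [integral_sub (hQi _) (integrable_const _)]; simp
    rw [h2, ← Real.norm_eq_abs]
    refine (norm_integral_le_of_norm_le_const (C := (1 / 2) ^ (a / t))
      (ae_of_all _ fun ω' => ?_)).trans (by simp)
    exact abs_sub_le_iff.2 ⟨h1 _ _, h1 _ _⟩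
  change |((μ.map X).prod (μ.map fun ω j => Z (k + a + j) ω)).real A -
    (μ.map fun ω => (X ω, fun j => Z (k + a + j) ω)).real A| ≤ _
  rw [hprod, hjoint, ← integral_sub
    (Integrable.of_mem_Icc 0 1 hPX.aemeasurable (ae_of_all _ fun _ => hP1 _))
    (Integrable.of_mem_Icc 0 1 hQX.aemeasurable
      (ae_of_all _ fun _ => hQ1 _ _)), ← Real.norm_eq_abs]
  refine (norm_integral_le_of_norm_le_const (C := (1 / 2) ^ (a / t))
    (ae_of_all _ fun ω => ?_)).trans (by simp)
  exact hdiff ω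

lemma IsMarkovChain.betaMixing_le (hZ : IsMarkovChain μ Z ν κ) {t : ℕ} (ht : 1 ≤ t)
    (hκ : HalvesOscillation (κ ^ t)) (a : ℕ) : betaMixing μ Z a ≤ (1 / 2) ^ (a / t) := by
  have : Nonempty {k : ℕ // 1 ≤ k} := ⟨⟨1, le_rfl⟩⟩
  exact ciSup_le fun k => hZ.tvDist_past_future_le ht hκ a k.1

/-- The bound `(1/2) ^ ⌊k / t⌋` is geometric. -/
lemma half_pow_div_le_geometric {t : ℕ} (ht : 1 ≤ t) (k : ℕ) :
    (1 / 2 : ℝ) ^ (k / t) ≤ 2 * ((1 / 2 : ℝ) ^ (1 / t : ℝ)) ^ k := by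
  have ht0 : (0 : ℝ) < t := by exact_mod_cast ht
  have h1 : (k : ℝ) / t ≤ (k / t : ℕ) + 1 := by
    rw [div_le_iff₀ ht0]
    have : k < (k / t + 1) * t := Nat.lt_mul_of_div_lt (Nat.lt_succ_self _) (by omega)
    exact_mod_cast this.le
  rw [← Real.rpow_mul_natCast (by norm_num), one_div_mul_eq_div]
  have h2 := Real.rpow_le_rpow_of_exponent_ge (by norm_num : (0 : ℝ) < 1 / 2) (by norm_num) h1
  rw [Real.rpow_add (by norm_num), Real.rpow_natCast, Real.rpow_one] at h2
  linarith

end BetaMixing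

/-! ### Rates -/

/-- The leading term at an effective sample size of order `n`. -/
lemma lambertGap_le_rate {t n : ℕ} (ht : 1 ≤ t) (hlog : 1 ≤ Real.log n) {x : ℝ}
    (hx : Real.exp 1 * nZero t ≤ x) (hnx : (n : ℝ) / 2 ≤ x) (hxn : x ≤ n) :
    lambertGap t x ≤ 6 * Real.sqrt (t * Real.log n / n) := by
  have hx0 := pos_of_exp_mul_nZero_le ht hx
  have hn0 : (0 : ℝ) < n := hx0.trans_le hxn
  have ht0 : (0 : ℝ) < t := by exact_mod_cast ht
  have hlx : Real.log x ≤ Real.log n := Real.log_le_log hx0 hxn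
  have hy : nZero t / x ≤ 9 / 2 * (t / n) := by
    rw [div_le_iff₀ hx0]
    have : 9 / 2 * ((t : ℝ) / n) * (n / 2) = nZero t := by unfold nZero; field_simp; norm_num
    rw [← this]
    gcongr
  have hy0 : 0 ≤ nZero t / x := (div_pos (nZero_pos ht) hx0).le
  have h9 : Real.sqrt (9 * (t * Real.log n / n)) = 3 * Real.sqrt (t * Real.log n / n) := by
    rw [Real.sqrt_mul (by norm_num), show (9 : ℝ) = 3 ^ 2 by norm_num,
      Real.sqrt_sq (by norm_num)]
  have h1 : Real.sqrt (2 * Real.log x * (nZero t / x)) ≤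
      Real.sqrt (9 * (t * Real.log n / n)) := by
    refine Real.sqrt_le_sqrt ?_
    calc 2 * Real.log x * (nZero t / x) ≤ 2 * Real.log n * (9 / 2 * (t / n)) := by gcongr
      _ = 9 * (t * Real.log n / n) := by ring
  have h2 : Real.sqrt (nZero t / x) ≤ Real.sqrt (9 * (t * Real.log n / n)) := by
    refine Real.sqrt_le_sqrt (hy.trans ?_)
    have : (t : ℝ) / n ≤ t * Real.log n / n := by
      gcongr
      exact le_mul_of_one_le_right ht0.le hlog
    have : 0 ≤ (t : ℝ) / n := by positivity
    linarith
  have := lambertGap_le ht hx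
  linarith

/-- Every term of a geometric sequence is at most the average of its predecessors. -/
lemma geometric_pow_le {ρ : ℝ} (h0 : 0 < ρ) (h1 : ρ < 1) {n : ℕ} (hn : 1 ≤ n) :
    ρ ^ n ≤ 1 / (1 - ρ) / n := by
  have hn0 : (0 : ℝ) < n := by exact_mod_cast hn
  have h2 : (n : ℝ) * ρ ^ n ≤ ∑ i ∈ Finset.range n, ρ ^ i := by
    calc (n : ℝ) * ρ ^ n = ∑ _i ∈ Finset.range n, ρ ^ n := by simp
      _ ≤ _ := Finset.sum_le_sum fun i hi =>
        pow_le_pow_of_le_one h0.le h1.le (Finset.mem_range.1 hi).le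
  have h3 : ∑ i ∈ Finset.range n, ρ ^ i ≤ 1 / (1 - ρ) := by
    rw [geom_sum_eq h1.ne, ← neg_div_neg_eq]
    have : 0 < 1 - ρ := by linarith
    have : 0 ≤ ρ ^ n := by positivity
    rw [neg_sub, neg_sub]
    gcongr
    linarith
  rw [le_div_iff₀ hn0]
  linarith

lemma sum_Icc_geometric_le {ρ : ℝ} (h0 : 0 < ρ) (h1 : ρ < 1) (n : ℕ) :
    ∑ i ∈ Finset.Icc 1 n, ρ ^ i ≤ 1 / (1 - ρ) := by
  rw [one_div]
  calc _ ≤ ∑' i : ℕ, ρ ^ i :=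
        (summable_geometric_of_lt_one h0.le h1).sum_le_tsum _ fun _ _ => by positivity
    _ = _ := tsum_geometric_of_lt_one h0.le h1

/-- A threshold for the sample size, depending only on `t`, `ρ` and `B`. It exists since
`r = ⌈log n / log (1 / ρ)⌉` is `o(√n)`, so that terms of order `(B + r) / n` are dominated by `√(1 / n)`. -/
lemma exists_rate_threshold (t : ℕ) {ρ : ℝ} (h0 : 0 < ρ) (h1 : ρ < 1) (B : ℝ) :
    ∃ n₁ : ℕ, ∀ n : ℕ, n₁ ≤ n → 1 ≤ n ∧ 1 ≤ Real.log n ∧ Real.exp 1 * nZero t ≤ (n : ℝ) / 2 ∧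
      (⌈Real.log n / Real.log (1 / ρ)⌉₊ : ℝ) ≤ n / 2 ∧
      (B + 1 + ⌈Real.log n / Real.log (1 / ρ)⌉₊) / n ≤ Real.sqrt (1 / n) := by
  have hL : 0 < Real.log (1 / ρ) := Real.log_pos (by rw [one_div]; exact (one_lt_inv₀ h0).2 h1)
  have hcast := tendsto_natCast_atTop_atTop (R := ℝ)
  have e1 := ((isLittleO_log_rpow_atTop (by norm_num : (0 : ℝ) < 1 / 2)).def
    (half_pos hL)).filter_mono le_rfl
  have e2 := (Real.tendsto_log_atTop).eventually_ge_atTop 1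
  have e3 := Filter.eventually_ge_atTop (2 * (Real.exp 1 * nZero t))
  have e4 := (Real.tendsto_sqrt_atTop).eventually_ge_atTop (2 * (|B| + 2))
  obtain ⟨n₁, hn₁⟩ := Filter.eventually_atTop.1
    (hcast.eventually (e1.and (e2.and (e3.and (e4.and (Filter.eventually_ge_atTop 4))))))
  refine ⟨n₁, fun n hn => ?_⟩
  obtain ⟨k1, k2, k3, k4, k5⟩ := hn₁ n hn
  have hn0 : (0 : ℝ) < n := by linarith
  rw [← Real.sqrt_eq_rpow, Real.norm_of_nonneg (by linarith),
    Real.norm_of_nonneg (Real.sqrt_nonneg _)] at k1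
  have hB := le_abs_self B
  have hB' := abs_nonneg B
  have hr : (⌈Real.log n / Real.log (1 / ρ)⌉₊ : ℝ) ≤ Real.sqrt n / 2 + 1 := by
    have h2 : Real.log n / Real.log (1 / ρ) ≤ Real.sqrt n / 2 := by
      rw [div_le_iff₀ hL]
      linarith
    have h3 := Nat.ceil_lt_add_one (div_nonneg (by linarith : 0 ≤ Real.log n) hL.le)
    linarith
  have hsq : Real.sqrt n * Real.sqrt n = n := Real.mul_self_sqrt hn0.le
  refine ⟨by exact_mod_cast (by linarith : (1 : ℝ) ≤ n), k2, by linarith, ?_, ?_⟩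
  · nlinarith
  · have hs0 : 0 < Real.sqrt n := Real.sqrt_pos.2 hn0
    rw [Real.sqrt_div zero_le_one, Real.sqrt_one, div_le_div_iff₀ hn0 hs0]
    calc _ ≤ Real.sqrt n * Real.sqrt n := by gcongr; linarith
      _ = 1 * n := by rw [hsq, one_mul]

section RateBounds

variable {t n : ℕ} {C ρ : ℝ} {δ : ℕ → ℝ}

/-- A geometric bound at a time `k ≥ n` is of order `1 / n`. -/
lemma geometric_bound_le (h0 : 0 < ρ) (h1 : ρ < 1) (hn : 1 ≤ n) {k : ℕ} (hk : n ≤ k) {a : ℝ}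
    (ha : a ≤ C * ρ ^ k) : a ≤ |C| / (1 - ρ) / n := by
  calc a ≤ C * ρ ^ k := ha
    _ ≤ |C| * ρ ^ n :=
        mul_le_mul (le_abs_self C) (pow_le_pow_of_le_one h0.le h1.le hk) (by positivity)
          (abs_nonneg C)
    _ ≤ |C| * (1 / (1 - ρ) / n) := by gcongr; exact geometric_pow_le h0 h1 hn
    _ = |C| / (1 - ρ) / n := by ring

lemma gapRestart_le_rate (ht : 1 ≤ t) (h0 : 0 < ρ) (h1 : ρ < 1) (hn : 1 ≤ n)
    (hlog : 1 ≤ Real.log n) (hexp : Real.exp 1 * nZero t ≤ n)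
    (hB : (4 * (|C| / (1 - ρ))) / n ≤ Real.sqrt (t * Real.log n / n))
    (hδ : ∀ k, 1 ≤ k → δ k ≤ C * ρ ^ k) :
    gapRestart t δ n ≤ 7 * Real.sqrt (t * Real.log n / n) := by
  have hn0 : (0 : ℝ) < n := by exact_mod_cast hn
  have hρ : 0 < 1 - ρ := by linarith
  have k1 := lambertGap_le_rate ht hlog hexp (by linarith) le_rfl
  have k2 : 1 / (n : ℝ) * ∑ i ∈ Finset.Icc 1 n, δ i ≤ |C| / (1 - ρ) / n := by
    have : ∑ i ∈ Finset.Icc 1 n, δ i ≤ |C| * (1 / (1 - ρ)) :=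
      calc _ ≤ ∑ i ∈ Finset.Icc 1 n, |C| * ρ ^ i := Finset.sum_le_sum fun i hi =>
            (hδ i (Finset.mem_Icc.1 hi).1).trans (by gcongr; exact le_abs_self C)
        _ = |C| * ∑ i ∈ Finset.Icc 1 n, ρ ^ i := by rw [Finset.mul_sum]
        _ ≤ _ := by gcongr; exact sum_Icc_geometric_le h0 h1 n
    calc _ ≤ 1 / (n : ℝ) * (|C| * (1 / (1 - ρ))) := by gcongr
      _ = _ := by ring
  have k3 := geometric_bound_le h0 h1 hn (Nat.le_succ n) (hδ (n + 1) (by omega))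
  have k4 : 0 ≤ |C| / (1 - ρ) / n := by positivity
  have k5 : (4 * (|C| / (1 - ρ))) / n = 4 * (|C| / (1 - ρ) / n) := by ring
  unfold gapRestart
  linarith

/-- The lag `r = ⌈log n / log (1 / ρ)⌉` is chosen so that `ρ ^ r ≤ 1 / n`. -/
lemma pow_ceil_log_le (h0 : 0 < ρ) (h1 : ρ < 1) (hn : 1 ≤ n) :
    ρ ^ ⌈Real.log n / Real.log (1 / ρ)⌉₊ ≤ 1 / n := by
  have hn0 : (0 : ℝ) < n := by exact_mod_cast hn
  have hL : 0 < Real.log (1 / ρ) := Real.log_pos (by rw [one_div]; exact (one_lt_inv₀ h0).2 h1)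
  have h2 := (div_le_iff₀ hL).1 (Nat.le_ceil (Real.log n / Real.log (1 / ρ)))
  rw [← Real.log_le_log_iff (by positivity) (by positivity), Real.log_pow, one_div, Real.log_inv]
  rw [one_div, Real.log_inv] at h2 ⊢
  linarith

lemma gapNoRestart_le_rate {β : ℕ → ℝ} {N r : ℕ} {α : ℝ} (ht : 1 ≤ t) (h0 : 0 < ρ) (h1 : ρ < 1)
    (hn : 1 ≤ n) (hlog : 1 ≤ Real.log n) (hexp : Real.exp 1 * nZero t ≤ (n : ℝ) - r)
    (hrn : (r : ℝ) ≤ n / 2) (hr : r = ⌈Real.log n / Real.log (1 / ρ)⌉₊) (hr1 : 1 ≤ r)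
    (hα1 : α < 1)
    (hB : (4 * (|C| / (1 - ρ)) + 1 + r) / n ≤ Real.sqrt (t * Real.log n / n))
    (hδ : ∀ k, 1 ≤ k → δ k ≤ C * ρ ^ k) (hβ : ∀ k, 1 ≤ k → β k ≤ C * ρ ^ k) :
    gapNoRestart t δ β α N n r ≤ 7 * Real.sqrt (t * Real.log n / n) + δ N ∧
      (r ≤ N → gapNoRestart t δ β α N n r ≤ 7 * Real.sqrt (t * Real.log n / n)) := by
  have hn0 : (0 : ℝ) < n := by exact_mod_cast hn
  have hρ : 0 < 1 - ρ := by linarith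
  have hr0 : (0 : ℝ) ≤ r := by positivity
  have k1 := lambertGap_le_rate ht hlog hexp (by linarith) (by linarith)
  have k2 : (1 + r * α) / ((n : ℝ) + 1) ≤ (1 + r) / n := by
    gcongr
    · nlinarith
    · linarith
  have k3 := geometric_bound_le h0 h1 hn (by omega : n ≤ n + N + 1) (hδ (n + N + 1) (by omega))
  have k4 := geometric_bound_le h0 h1 hn (by omega : n ≤ n + 1) (hβ (n + 1) (by omega))
  have k6 : ∀ k, r ≤ k → ∀ a, a ≤ C * ρ ^ k → a ≤ |C| / (1 - ρ) / n := fun k hk a ha => by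
    calc a ≤ C * ρ ^ k := ha
      _ ≤ |C| * ρ ^ r :=
          mul_le_mul (le_abs_self C) (pow_le_pow_of_le_one h0.le h1.le hk) (by positivity)
            (abs_nonneg C)
      _ ≤ |C| * (1 / n) := by gcongr; rw [hr]; exact pow_ceil_log_le h0 h1 hn
      _ = |C| / n := by ring
      _ ≤ |C| / (1 - ρ) / n := by
          gcongr
          exact le_div_self (abs_nonneg C) hρ (by linarith)
  have k7 := k6 r le_rfl _ (hβ r hr1)
  have k8 : 0 ≤ |C| / (1 - ρ) / n := by positivity
  have k9 : (4 * (|C| / (1 - ρ)) + 1 + r) / n = 4 * (|C| / (1 - ρ) / n) + (1 + r) / n := by ring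
  unfold gapNoRestart
  refine ⟨by linarith, fun hN => ?_⟩
  have k10 := k6 N hN _ (hδ N (by omega))
  linarith

end RateBounds

end MarkovConformal

theorem mainTheorem1 :
    -- Coverage with a restart: calibration and test points come from an independent chain `Z'`.
    (∀ (𝒳 : Type u) (𝒴 : Type v) (Ω : Type w)
        [MeasurableSpace 𝒳] [MeasurableSpace 𝒴] [MeasurableSpace Ω]
        (μ : Measure Ω) [IsProbabilityMeasure μ]
        (κ : Kernel (𝒳 × 𝒴) (𝒳 × 𝒴)) [IsMarkovKernel κ]
        (π ν₀ ν₁ : Measure (𝒳 × 𝒴)) [IsProbabilityMeasure π]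
        (Z Z' : ℕ → Ω → 𝒳 × 𝒴) (tmix N n : ℕ) (α : ℝ)
        (s : (Fin N → 𝒳 × 𝒴) → 𝒳 × 𝒴 → ℝ),
        IsIrreducibleAperiodic κ π → mixingTime κ π = tmix →
        IsMarkovChain μ Z ν₀ κ → IsMarkovChain μ Z' ν₁ κ →
        IndepFun (fun ω k => Z k ω) (fun ω k => Z' k ω) μ →
        Measurable (Function.uncurry s) →
        1 ≤ N → 0 < α → α < 1 → Real.exp 1 * nZero tmix ≤ n →
        1 - α - gapRestart tmix (tvToStationary κ ν₁ π) n ≤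
            μ.real (coverageEvent s (trainingSet Z N) Z' 0 n α) ∧
          ((∀ᵐ ω ∂μ, ∀ c : ℝ, π {z | s (trainingSet Z N ω) z = c} = 0) →
            μ.real (coverageEvent s (trainingSet Z N) Z' 0 n α) ≤
              1 - α + gapRestart tmix (tvToStationary κ ν₁ π) n + (1 - α) / n)) ∧
    -- Coverage without a restart: all points come from the same trajectory.
    (∀ (𝒳 : Type u) (𝒴 : Type v) (Ω : Type w)
        [MeasurableSpace 𝒳] [MeasurableSpace 𝒴] [MeasurableSpace Ω]
        (μ : Measure Ω) [IsProbabilityMeasure μ]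
        (κ : Kernel (𝒳 × 𝒴) (𝒳 × 𝒴)) [IsMarkovKernel κ]
        (π ν₀ : Measure (𝒳 × 𝒴)) [IsProbabilityMeasure π]
        (Z : ℕ → Ω → 𝒳 × 𝒴) (tmix N n r : ℕ) (α : ℝ)
        (s : (Fin N → 𝒳 × 𝒴) → 𝒳 × 𝒴 → ℝ),
        IsIrreducibleAperiodic κ π → mixingTime κ π = tmix →
        IsMarkovChain μ Z ν₀ κ →
        Measurable (Function.uncurry s) →
        1 ≤ N → 0 < α → α < 1 → 1 ≤ r → Real.exp 1 * nZero tmix ≤ (n : ℝ) - r →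
        1 - α - gapNoRestart tmix (tvToStationary κ ν₀ π) (betaMixing μ Z) α N n r ≤
            μ.real (coverageEvent s (trainingSet Z N) Z N n α) ∧
          ((∀ᵐ ω ∂μ, ∀ c : ℝ, π {z | s (trainingSet Z N ω) z = c} = 0) →
            μ.real (coverageEvent s (trainingSet Z N) Z N n α) ≤
              1 - α + gapNoRestart tmix (tvToStationary κ ν₀ π) (betaMixing μ Z) α N n r +
                (1 - α) / ((n : ℝ) - r))) ∧
    -- Geometrically ergodic chains: the constants `C` and `ρ` exist.
    (∀ (𝒳 : Type u) (𝒴 : Type v) (Ω : Type w)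
        [MeasurableSpace 𝒳] [MeasurableSpace 𝒴] [MeasurableSpace Ω]
        (μ : Measure Ω) [IsProbabilityMeasure μ]
        (κ : Kernel (𝒳 × 𝒴) (𝒳 × 𝒴)) [IsMarkovKernel κ]
        (π ν : Measure (𝒳 × 𝒴)) [IsProbabilityMeasure π]
        (Z : ℕ → Ω → 𝒳 × 𝒴) (tmix : ℕ),
        IsIrreducibleAperiodic κ π → IsGeometricallyErgodic κ π → mixingTime κ π = tmix →
        IsMarkovChain μ Z ν κ →
        ∃ C ρ : ℝ, 0 < ρ ∧ ρ < 1 ∧ ∀ k : ℕ, 1 ≤ k →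
          tvToStationary κ ν π k ≤ C * ρ ^ k ∧ betaMixing μ Z k ≤ C * ρ ^ k) ∧
    -- The rate, with an absolute constant `K` and a threshold `n₁` depending on `t_mix`, `C`, `ρ`.
    (∃ K : ℝ, 0 < K ∧ ∀ (tmix : ℕ) (C ρ : ℝ), 0 < ρ → ρ < 1 → ∃ n₁ : ℕ,
      ∀ (𝒳 : Type u) (𝒴 : Type v) (Ω : Type w)
        [MeasurableSpace 𝒳] [MeasurableSpace 𝒴] [MeasurableSpace Ω]
        (μ : Measure Ω) [IsProbabilityMeasure μ]
        (κ : Kernel (𝒳 × 𝒴) (𝒳 × 𝒴)) [IsMarkovKernel κ]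
        (π ν : Measure (𝒳 × 𝒴)) [IsProbabilityMeasure π]
        (Z : ℕ → Ω → 𝒳 × 𝒴),
        IsIrreducibleAperiodic κ π → IsGeometricallyErgodic κ π → mixingTime κ π = tmix →
        IsMarkovChain μ Z ν κ →
        (∀ k : ℕ, 1 ≤ k → tvToStationary κ ν π k ≤ C * ρ ^ k) →
        ∀ n : ℕ, n₁ ≤ n →
          -- restart, with calibration chain started from `ν`
          (Real.exp 1 * nZero tmix ≤ n ∧
            gapRestart tmix (tvToStationary κ ν π) n ≤ K * Real.sqrt (tmix * Real.log n / n)) ∧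
          -- no restart, with `r = ⌈log n / log (1/ρ)⌉`
          ((∀ k : ℕ, 1 ≤ k → betaMixing μ Z k ≤ C * ρ ^ k) →
            ∀ (N r : ℕ) (α : ℝ), 1 ≤ N → 0 < α → α < 1 →
            r = ⌈Real.log n / Real.log (1 / ρ)⌉₊ →
            1 ≤ r ∧ Real.exp 1 * nZero tmix ≤ (n : ℝ) - r ∧
            gapNoRestart tmix (tvToStationary κ ν π) (betaMixing μ Z) α N n r ≤
              K * Real.sqrt (tmix * Real.log n / n) + tvToStationary κ ν π N ∧
            (r ≤ N →
              gapNoRestart tmix (tvToStationary κ ν π) (betaMixing μ Z) α N n r ≤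
                K * Real.sqrt (tmix * Real.log n / n)))) := by
  refine ⟨?_, ?_, ?_, ?_⟩
  · intro 𝒳 𝒴 Ω _ _ _ μ _ κ _ π ν₀ ν₁ _ Z Z' tmix N n α s hirr hmix hZ hZ' hind hs hN hα hα1 hn
    obtain ⟨ht, hκ⟩ := mixingTime_spec hmix
    exact coverageEvent_restart hZ hZ' hind ht hκ hs hα hα1 hn
  · intro 𝒳 𝒴 Ω _ _ _ μ _ κ _ π ν₀ _ Z tmix N n r α s hirr hmix hZ hs hN hα hα1 hr hn
    obtain ⟨ht, hκ⟩ := mixingTime_spec hmix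
    exact hZ.coverageEvent_noRestart hirr.invariant ht hκ hs hα hα1 hn
  · intro 𝒳 𝒴 Ω _ _ _ μ _ κ _ π ν _ Z tmix hirr hgeo hmix hZ
    obtain ⟨ht, hκ⟩ := mixingTime_spec hmix
    have := hZ.isProbabilityMeasure
    have ht0 : (0 : ℝ) < tmix := by exact_mod_cast ht
    exact ⟨2, (1 / 2 : ℝ) ^ (1 / tmix : ℝ), by positivity,
      Real.rpow_lt_one (by norm_num) (by norm_num) (by positivity), fun k _ =>
      ⟨(tvToStationary_le hirr.invariant ht hκ k).trans (half_pow_div_le_geometric ht k),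
        (hZ.betaMixing_le ht hκ k).trans (half_pow_div_le_geometric ht k)⟩⟩
  -- `7 = 6 + 1`: the leading term, and all the others together
  · refine ⟨7, by norm_num, fun tmix C ρ h0 h1 => ?_⟩
    obtain ⟨n₁, hn₁⟩ := exists_rate_threshold tmix h0 h1 (4 * (|C| / (1 - ρ)))
    refine ⟨n₁, ?_⟩
    intro 𝒳 𝒴 Ω _ _ _ μ _ κ _ π ν _ Z hirr hgeo hmix hZ hδ n hn
    obtain ⟨ht, -⟩ := mixingTime_spec hmix
    obtain ⟨hn1, hlog, hexp, hceil, hB⟩ := hn₁ n hn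
    have hn0 : (0 : ℝ) < n := by exact_mod_cast hn1
    have ht1 : (1 : ℝ) ≤ tmix := by exact_mod_cast ht
    have hB' := hB.trans (Real.sqrt_le_sqrt (show 1 / (n : ℝ) ≤ tmix * Real.log n / n by
      gcongr
      nlinarith))
    refine ⟨⟨by linarith, gapRestart_le_rate ht h0 h1 hn1 hlog (by linarith) (le_trans ?_ hB') hδ⟩,
      fun hβ N r α hN hα hα1 hr => ?_⟩
    · gcongr
      have : (0 : ℝ) ≤ ⌈Real.log n / Real.log (1 / ρ)⌉₊ := by positivity
      linarith
    · rw [← hr] at hceil hB'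
      have hL : 0 < Real.log (1 / ρ) :=
        Real.log_pos (by rw [one_div]; exact (one_lt_inv₀ h0).2 h1)
      have hr1 : 1 ≤ r := by
        rw [hr]
        exact Nat.ceil_pos.2 (div_pos (by linarith) hL)
      have hexp' : Real.exp 1 * nZero tmix ≤ (n : ℝ) - r := by linarith
      exact ⟨hr1, hexp', gapNoRestart_le_rate ht h0 h1 hn1 hlog hexp' hceil hr hr1 hα1 hB' hδ hβ⟩
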